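/- Let $2<p<\infty$, let $L_p(\mathbb R)$ be the Banach space of (classes of) real-valued $p$-integrable functions on $\mathbb R$ with Lebesgue measure, and for $\lambda\in\mathbb R$ let $T_\lambda$ be the translation operator $(T_\lambda f)(x)=f(x-\lambda)$. Then there exists a single $f\in L_p(\mathbb R)$ such that the translates $f_i=T_{-3^i}f$, $i=1,2,3,\dots$, with closed linear span $X=\overline{\operatorname{span}}\{f_i:i\ge 1\}$ in $L_p(\mathbb R)$, have all of the following properties: i) $(f_i)_{i=1}^\infty$ is a basic sequence, i.e. a Schauder basis of $X$; ii) $L_p(\mathbb R)$ embeds isomorphically into $X$, i.e. there are a bounded linear operator $S:L_p(\mathbb R)\to X$ and a constant $c>0$ with $\|Sg\|\ge c\|g\|$ for all $g\in L_p(\mathbb R)$; iii) $(f_i)$ can be blocked into an unconditional finite dimensional decomposition (FDD): there is a partition of $\{1,2,3,\dots\}$ into successive nonempty finite intervals $J_1,J_2,\dots$ such that, with $F_j=\operatorname{span}\{f_i:i\in J_j\}$, every $x\in X$ has a unique expansion $x=\sum_{j=1}^\infty x_j$ with $x_j\in F_j$ for all $j$, and this series converges unconditionally for every $x\in X$. 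-/

import Mathlib

open MeasureTheory Filter Topology
open scoped ENNReal

noncomputable section

/-- The translation operator `T_l` on `L_p(ℝ)`, `(T_l f)(x) = f (x - l)` (a linear isometry). -/
def lpTranslate (p : ℝ≥0∞) [Fact (1 ≤ p)] (l : ℝ) :
    Lp ℝ p (volume : Measure ℝ) →ₗᵢ[ℝ] Lp ℝ p (volume : Measure ℝ) :=
  Lp.compMeasurePreservingₗᵢ ℝ (fun x : ℝ => x - l) (measurePreserving_sub_right volume l)

section BanachSpace

variable {E : Type*} [NormedAddCommGroup E] [NormedSpace ℝ E]

/-- The closed linear span of a sequence. -/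
def closedSpan (u : ℕ → E) : Submodule ℝ E :=
  (Submodule.span ℝ (Set.range u)).topologicalClosure

/-- A sequence is basic if it is a Schauder basis of its closed linear span. -/
def IsBasicSequence (u : ℕ → E) : Prop :=
  ∃ b : SchauderBasis ℝ (closedSpan u), ∀ i, (b i : E) = u i

/-- `(F j)` is a finite dimensional decomposition (FDD) of the subspace `X`: the `F j` are finite
dimensional subspaces of `X`, and every `x ∈ X` is `∑ j, y j` (limit of the partial sums) for a
unique sequence `y` with `y j ∈ F j`. -/
def IsFDD (F : ℕ → Submodule ℝ E) (X : Submodule ℝ E) : Prop :=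
  (∀ j, F j ≤ X) ∧ (∀ j, FiniteDimensional ℝ (F j)) ∧
    ∀ x ∈ X, ∃! y : ℕ → E, (∀ j, y j ∈ F j) ∧
      Tendsto (fun n => ∑ j ∈ Finset.range n, y j) atTop (𝓝 x)

/-- An FDD is unconditional if all the expansions converge unconditionally
(`HasSum` is convergence along the net of all finite sets of indices). -/
def IsUnconditionalFDD (F : ℕ → Submodule ℝ E) (X : Submodule ℝ E) : Prop :=
  IsFDD F X ∧ ∀ x ∈ X, ∀ y : ℕ → E, (∀ j, y j ∈ F j) →
    Tendsto (fun n => ∑ j ∈ Finset.range n, y j) atTop (𝓝 x) → HasSum y x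

/-- The sequence `u` can be blocked into an unconditional FDD: there is a partition of the index
set into successive nonempty finite intervals `J j = [n j, n (j + 1))` such that the spaces
`span {u i : i ∈ J j}` form an unconditional FDD of the closed linear span of `u`. -/
def CanBeBlockedIntoUnconditionalFDD (u : ℕ → E) : Prop :=
  ∃ n : ℕ → ℕ, n 0 = 0 ∧ StrictMono n ∧
    IsUnconditionalFDD
      (fun j => Submodule.span ℝ (u '' Set.Ico (n j) (n (j + 1)))) (closedSpan u)

end BanachSpace

/-- `V` embeds isomorphically into `W`: there is a bounded linear map `V → W` that is bounded
below. -/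
def EmbedsIsomorphically (V W : Type*) [NormedAddCommGroup V] [NormedSpace ℝ V]
    [NormedAddCommGroup W] [NormedSpace ℝ W] : Prop :=
  ∃ T : V →L[ℝ] W, ∃ c : ℝ, 0 < c ∧ ∀ x, c * ‖x‖ ≤ ‖T x‖

/-- The translates `f_i = T_{-3^i} f`, `i = 1, 2, …`; the Lean index is `i - 1`. -/
def powThreeTranslates (p : ℝ≥0∞) [Fact (1 ≤ p)] (f : Lp ℝ p (volume : Measure ℝ)) :
    ℕ → Lp ℝ p (volume : Measure ℝ) :=
  fun i => lpTranslate p (-(3 : ℝ) ^ (i + 1)) f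

end

/-!
Put `q = p.toReal > 2`. The function is `f = ∑ j, T_{3^j} g_j`, where the `g_j` are supported in the
window `(-3, 3)` and `∑ j, ‖g_j‖ ^ q < ∞`. The differences `3 ^ j - 3 ^ i`, `i ≠ j`, are distinct
nonzero multiples of `6`, so `f_i = g_i + r_i`, where the `r_i` have norm at most `‖f‖` and are
supported in disjoint sets off the window (`exists_powThreeTranslates_eq_add`). Hence
`‖∑ a_i f_i‖ ^ q = ‖∑ a_i g_i‖ ^ q + ∑ |a_i| ^ q ‖r_i‖ ^ q`, and it remains to choose the `g_i`.

Let `H_n` be the normalized Haar functions of the line, an unconditional basis of `L_p(ℝ)`, and let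
`J` be an isometric embedding of `L_p(ℝ)` into the functions supported in `(-2, 2)`. To the Haar
function `H_n` belongs a block of `2 ^ n` indices. If all the `g_i` in the block were multiples of
`J H_n`, say `g_i = c_n J H_n`, then `∑ ‖g_i‖ ^ q < ∞` would be compatible with flat averages of the
`f_i` over the blocks being small perturbations of multiples of the `J H_n`, precisely because
`q > 2`: a flat sum of `N` terms gains `N` in the direction `J H_n`, but only `N ^ (1 / q)` in `ℓ_q`.
However, the `f_i` would not be basic. So `g_i` is taken to be `γ ^ n (ρ ^ n J H_n + Z_i)`, where the
`Z_i` live in an interval of their own and encode the weighted differences `w_v` of the sums of the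
`a_i` over the two halves of the dyadic subintervals of the block, with weight `ρ ^ h` at height `h`
(`treeSum`, `exists_norm_sum_rpow_eq_treeSum`). Flat sums have no `Z` part. As `1 / 2 < ρ < 1`,
truncations are bounded uniformly in the depth of the tree (`exists_treeSum_truncate_le`), which
makes `(f_i)` basic; for `ρ` close to `1` little of the gain of flat sums is lost
(`exists_tree_parameters`). The blocks are unconditional since `(H_n)` is, and
`x ↦ J x + ∑ n, φ_n x • t_n`, with `φ_n` the coordinate functionals of the Haar basis and `J H_n + t_n`
the normalized flat sum of block `n`, embeds `L_p(ℝ)`; it does not decrease norms because the `t_n`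
vanish on the window.

The unconditionality of the Haar system is proved by Burkholder's method: `burkholderFun` is concave
along lines of slope `±1` and majorizes `(|y| ^ q - C |x| ^ q) / 2`, so its integral along a Haar sum
`x` and its transform `y` by signs is at most `0`.
-/

/-! ### Basic sequences and unconditional blockings -/

section BasicSequences

variable {E : Type*} [NormedAddCommGroup E] [NormedSpace ℝ E]

/-- The partial sum operators of the sequence `u` are bounded by `K` on finite combinations. -/
def HasBasisConstant (u : ℕ → E) (K : ℝ) : Prop :=
  ∀ (a : ℕ → ℝ) (n m : ℕ), n ≤ m →
    ‖∑ i ∈ Finset.range n, a i • u i‖ ≤ K * ‖∑ i ∈ Finset.range m, a i • u i‖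

lemma exists_eq_sum_range_of_mem_span {u : ℕ → E} {x : E}
    (hx : x ∈ Submodule.span ℝ (Set.range u)) :
    ∃ (a : ℕ → ℝ) (N : ℕ), (∀ i, N ≤ i → a i = 0) ∧ x = ∑ i ∈ Finset.range N, a i • u i := by
  obtain ⟨c, rfl⟩ := Finsupp.mem_span_range_iff_exists_finsupp.1 hx
  refine ⟨c, c.support.sup id + 1, fun i hi => ?_, ?_⟩
  · by_contra h
    have := Finset.le_sup (f := id) (Finsupp.mem_support_iff.2 h)
    simp only [id] at this
    omega
  · refine Finset.sum_subset (fun i hi => ?_) (fun i _ hi => ?_)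
    · have := Finset.le_sup (f := id) hi
      simp only [id] at this
      simp only [Finset.mem_range]
      omega
    · simp [Finsupp.notMem_support_iff.1 hi]

namespace HasBasisConstant

variable {u : ℕ → E} {K : ℝ}

lemma norm_coeff_smul_le (hK : HasBasisConstant u K) (a : ℕ → ℝ) {n m : ℕ} (h : n < m) :
    ‖a n • u n‖ ≤ 2 * K * ‖∑ i ∈ Finset.range m, a i • u i‖ := by
  have h1 := hK a n m h.le
  have h2 := hK a (n + 1) m h
  have h3 : a n • u n = ∑ i ∈ Finset.range (n + 1), a i • u i
      - ∑ i ∈ Finset.range n, a i • u i := by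
    rw [Finset.sum_range_succ, add_sub_cancel_left]
  rw [h3]
  refine (norm_sub_le _ _).trans ?_
  linarith

lemma linearIndependent (hK : HasBasisConstant u K) (h0 : ∀ i, u i ≠ 0) :
    LinearIndependent ℝ u := by
  rw [linearIndependent_iff']
  intro s g hs i hi
  let a : ℕ → ℝ := fun j => if j ∈ s then g j else 0
  have hsum : ∑ j ∈ Finset.range (s.sup id + 1), a j • u j = 0 := by
    rw [← hs]
    symm
    refine Finset.sum_subset_zero_on_sdiff (fun j hj => ?_) (fun j hj => ?_) (fun j hj => ?_)
    · have := Finset.le_sup (f := id) hj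
      simp only [id] at this
      simp only [Finset.mem_range]
      omega
    · simp [a, (Finset.mem_sdiff.1 hj).2]
    · simp [a, hj]
  have hi' : i < s.sup id + 1 := by
    have := Finset.le_sup (f := id) hi
    simp only [id] at this
    omega
  have := hK.norm_coeff_smul_le a hi'
  rw [hsum, norm_zero, mul_zero] at this
  have h2 := norm_le_zero_iff.1 this
  simpa [a, hi, h0 i] using h2

/-- The biorthogonal functionals, extended to the whole space, and the expansion of the vectors of
the closed linear span. -/
theorem exists_coord (hK : HasBasisConstant u K) (h0 : ∀ i, u i ≠ 0) :
    ∃ φ : ℕ → (E →L[ℝ] ℝ), (∀ i j, φ i (u j) = if i = j then 1 else 0) ∧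
      (∀ i, ‖φ i‖ * ‖u i‖ ≤ 2 * K) ∧
      ∀ x ∈ closedSpan u,
        Tendsto (fun n => ∑ i ∈ Finset.range n, φ i x • u i) atTop (𝓝 x) := by
  have hli := hK.linearIndependent h0
  have hKpos : 0 ≤ K := by
    have := hK (fun _ => 1) 1 1 le_rfl
    have h1 : 0 < ‖u 0‖ := norm_pos_iff.2 (h0 0)
    simp only [Finset.range_one, Finset.sum_singleton, one_smul] at this
    nlinarith
  have hb : ∀ i, ∀ x : Submodule.span ℝ (Set.range u),
      ‖(Finsupp.lapply i ∘ₗ hli.repr : _ →ₗ[ℝ] ℝ) x‖ ≤ 2 * K / ‖u i‖ * ‖x‖ := by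
    intro i x
    have h1 : 0 < ‖u i‖ := norm_pos_iff.2 (h0 i)
    rw [div_mul_eq_mul_div, le_div_iff₀ h1, ← norm_smul]
    obtain ⟨a, N, ha, hx⟩ := exists_eq_sum_range_of_mem_span x.2
    have hrep : hli.repr x = ∑ j ∈ Finset.range N, Finsupp.single j (a j) := by
      have : x = ∑ j ∈ Finset.range N, a j •
          (⟨u j, Submodule.subset_span (Set.mem_range_self j)⟩ :
            Submodule.span ℝ (Set.range u)) := by
        apply Subtype.ext
        rw [hx]
        simp
      rw [this, map_sum]
      refine Finset.sum_congr rfl fun j _ => ?_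
      rw [map_smul, hli.repr_eq_single j _ rfl]
      simp
    have hval : (Finsupp.lapply i ∘ₗ hli.repr : _ →ₗ[ℝ] ℝ) x = a i := by
      rw [LinearMap.comp_apply, hrep]
      simp only [Finsupp.lapply_apply, Finsupp.finsetSum_apply, Finsupp.single_apply,
        Finset.sum_ite_eq', Finset.mem_range]
      split_ifs with h
      · rfl
      · exact (ha i (not_lt.1 h)).symm
    rw [hval]
    by_cases h : i < N
    · have := hK.norm_coeff_smul_le a h
      rwa [← hx] at this
    · rw [ha i (not_lt.1 h), zero_smul, norm_zero]
      positivity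
  choose φ hφ hφn using fun i => exists_extension_norm_eq _
    (LinearMap.mkContinuous _ _ (hb i))
  have hortho : ∀ i j, φ i (u j) = if i = j then 1 else 0 := by
    intro i j
    have := hφ i ⟨u j, Submodule.subset_span (Set.mem_range_self j)⟩
    rw [this]
    simp only [LinearMap.mkContinuous_apply, LinearMap.comp_apply]
    rw [hli.repr_eq_single j _ rfl]
    simp [Finsupp.single_apply, eq_comm]
  refine ⟨φ, hortho, fun i => ?_, ?_⟩
  · rw [hφn]
    have h1 : 0 < ‖u i‖ := norm_pos_iff.2 (h0 i)
    rw [← le_div_iff₀ h1]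
    exact LinearMap.mkContinuous_norm_le _ (by positivity) _
  · have happ : ∀ (a : ℕ → ℝ) N, (∀ i, N ≤ i → a i = 0) → ∀ i,
        φ i (∑ j ∈ Finset.range N, a j • u j) = a i := by
      intro a N ha i
      simp only [map_sum, map_smul, hortho, smul_eq_mul, mul_ite, mul_one, mul_zero,
        Finset.sum_ite_eq, Finset.mem_range]
      split_ifs with h
      · rfl
      · exact (ha i (not_lt.1 h)).symm
    have hbound : ∀ n, ∀ x ∈ closedSpan u,
        ‖∑ i ∈ Finset.range n, φ i x • u i‖ ≤ K * ‖x‖ := by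
      intro n x hx
      have hcl : IsClosed {x : E | ‖∑ i ∈ Finset.range n, φ i x • u i‖ ≤ K * ‖x‖} :=
        isClosed_le (by fun_prop) (by fun_prop)
      refine closure_minimal ?_ hcl hx
      intro y hy
      obtain ⟨a, N, ha, rfl⟩ := exists_eq_sum_range_of_mem_span hy
      simp only [Set.mem_ofPred_eq, happ a N ha]
      have h1 : ∑ i ∈ Finset.range N, a i • u i = ∑ i ∈ Finset.range (max n N), a i • u i := by
        refine Finset.sum_subset (by simp) fun i _ hi => ?_
        rw [ha i (by simpa using hi), zero_smul]
      rw [h1]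
      exact hK a n _ (le_max_left _ _)
    intro x hx
    rw [Metric.tendsto_atTop]
    intro ε hε
    obtain ⟨y, hy, hxy⟩ := Metric.mem_closure_iff.1 hx (ε / (K + 2)) (by positivity)
    obtain ⟨a, N, ha, rfl⟩ := exists_eq_sum_range_of_mem_span hy
    refine ⟨N, fun n hn => ?_⟩
    set y := ∑ i ∈ Finset.range N, a i • u i with hydef
    have hyn : ∑ i ∈ Finset.range n, φ i y • u i = y := by
      simp only [hydef, happ a N ha]
      symm
      refine Finset.sum_subset (by simpa using hn) fun i _ hi => ?_
      rw [ha i (by simpa using hi), zero_smul]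
    have hyX : y ∈ closedSpan u := Submodule.le_topologicalClosure _ hy
    have h1 := hbound n (x - y) (Submodule.sub_mem _ hx hyX)
    simp only [map_sub, sub_smul, Finset.sum_sub_distrib, hyn] at h1
    rw [dist_eq_norm]
    rw [dist_eq_norm] at hxy
    have h2 : ∑ i ∈ Finset.range n, φ i x • u i - x
        = (∑ i ∈ Finset.range n, φ i x • u i - y) - (x - y) := by abel
    rw [h2]
    refine (norm_sub_le _ _).trans_lt ?_
    have h3 : ‖x - y‖ * (K + 2) < ε := (lt_div_iff₀ (by positivity)).1 hxy
    nlinarith [norm_nonneg (x - y)]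

theorem isBasicSequence (hK : HasBasisConstant u K) (h0 : ∀ i, u i ≠ 0) :
    IsBasicSequence u := by
  obtain ⟨φ, hφ, -, hexp⟩ := hK.exists_coord h0
  have hmem : ∀ i, u i ∈ closedSpan u := fun i =>
    Submodule.le_topologicalClosure _ (Submodule.subset_span (Set.mem_range_self i))
  refine ⟨⟨fun i => ⟨u i, hmem i⟩, fun i => (φ i).comp (closedSpan u).subtypeL, ?_, ?_⟩,
    fun i => rfl⟩
  · intro i j
    simp [hφ, Pi.single_apply]
  · intro x
    rw [HasSum, SummationFilter.conditional_filter_eq_map_range, tendsto_map'_iff]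
    rw [tendsto_subtype_rng]
    refine (hexp x x.2).congr fun n => ?_
    simp

/-- If the block projections onto finite unions of consecutive blocks of a basic sequence are
uniformly bounded, then the blocking is an unconditional finite dimensional decomposition. -/
theorem canBeBlocked (hK : HasBasisConstant u K) (h0 : ∀ i, u i ≠ 0) {n : ℕ → ℕ}
    (hn0 : n 0 = 0) (hn : StrictMono n) {C : ℝ}
    (hC : ∀ y : ℕ → E, (∀ j, y j ∈ Submodule.span ℝ (u '' Set.Ico (n j) (n (j + 1)))) →
      ∀ (N : ℕ) (A : Finset ℕ), A ⊆ Finset.range N →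
        ‖∑ j ∈ A, y j‖ ≤ C * ‖∑ j ∈ Finset.range N, y j‖) :
    CanBeBlockedIntoUnconditionalFDD u := by
  obtain ⟨φ, hφ, -, hexp⟩ := hK.exists_coord h0
  have hblock : ∀ (j : ℕ) (y : E), y ∈ Submodule.span ℝ (u '' Set.Ico (n j) (n (j + 1))) →
      y = ∑ i ∈ Finset.Ico (n j) (n (j + 1)), φ i y • u i := by
    intro j y hy
    induction hy using Submodule.span_induction with
    | mem x hx =>
      obtain ⟨i, hi, rfl⟩ := hx
      simp only [hφ, ite_smul, one_smul, zero_smul, Finset.sum_ite_eq', Finset.mem_Ico]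
      rw [if_pos (by simpa using hi)]
    | zero => simp
    | add x y _ _ hx hy =>
      simp only [map_add, add_smul, Finset.sum_add_distrib]
      rw [← hx, ← hy]
    | smul c x _ hx =>
      simp only [map_smul, smul_eq_mul, mul_smul]
      rw [← Finset.smul_sum, ← hx]
  have hblock0 : ∀ (j : ℕ) (y : E), y ∈ Submodule.span ℝ (u '' Set.Ico (n j) (n (j + 1))) →
      ∀ i, i ∉ Set.Ico (n j) (n (j + 1)) → φ i y = 0 := by
    intro j y hy i hi
    rw [hblock j y hy]
    simp only [map_sum, map_smul, hφ, smul_eq_mul, mul_ite, mul_one, mul_zero,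
      Finset.sum_ite_eq, Finset.mem_Ico]
    rw [if_neg (by simpa using hi)]
  have hpart : ∀ (c : ℕ → E) N, ∑ j ∈ Finset.range N, ∑ i ∈ Finset.Ico (n j) (n (j + 1)), c i
      = ∑ i ∈ Finset.range (n N), c i := by
    intro c N
    induction N with
    | zero => simp [hn0]
    | succ N ih =>
      rw [Finset.sum_range_succ, ih, Finset.range_eq_Ico, Finset.range_eq_Ico,
        Finset.sum_Ico_consecutive _ (Nat.zero_le _) (hn.monotone (Nat.le_succ N))]
  refine ⟨n, hn0, hn, ⟨fun j => ?_, fun j => ?_, fun x hx => ?_⟩, ?_⟩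
  · refine (Submodule.span_mono (Set.image_subset_range _ _)).trans
      (Submodule.le_topologicalClosure _)
  · exact FiniteDimensional.span_of_finite ℝ ((Set.finite_Ico _ _).image u)
  · refine ⟨fun j => ∑ i ∈ Finset.Ico (n j) (n (j + 1)), φ i x • u i, ⟨fun j => ?_, ?_⟩, ?_⟩
    · exact Submodule.sum_mem _ fun i hi => Submodule.smul_mem _ _
        (Submodule.subset_span ⟨i, by simpa using hi, rfl⟩)
    · simp only [hpart]
      exact (hexp x hx).comp hn.tendsto_atTop
    · rintro y ⟨hy, hlim⟩
      funext j
      rw [hblock j _ (hy j)]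
      refine Finset.sum_congr rfl fun i hi => ?_
      congr 1
      -- the `i`-th coordinate of the partial sums is eventually that of the `j`-th block
      have h1 : Tendsto (fun N => φ i (∑ k ∈ Finset.range N, y k)) atTop (𝓝 (φ i x)) :=
        ((φ i).continuous.tendsto x).comp hlim
      refine tendsto_nhds_unique_of_eventuallyEq tendsto_const_nhds h1 ?_
      filter_upwards [eventually_gt_atTop j] with N hN
      rw [map_sum, Finset.sum_eq_single_of_mem j (Finset.mem_range.2 hN)]
      intro k _ hk
      refine hblock0 k _ (hy k) i fun hik => hk ?_
      rw [Finset.mem_Ico] at hi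
      rcases lt_trichotomy k j with h | h | h
      · have := hn.monotone (Nat.succ_le_of_lt h)
        have := hik.2
        simp only [Nat.succ_eq_add_one] at *
        omega
      · exact h
      · have := hn.monotone (Nat.succ_le_of_lt h)
        have := hik.1
        simp only [Nat.succ_eq_add_one] at *
        omega
  · intro x _ y hy hlim
    rw [HasSum, SummationFilter.unconditional_filter, Metric.tendsto_atTop]
    intro ε hε
    have hC0 : 0 < |C| + 1 := by positivity
    obtain ⟨N, hN⟩ := Metric.tendsto_atTop.1 hlim (ε / (2 * (|C| + 1) + 1)) (by positivity)
    refine ⟨Finset.range N, fun s hs => ?_⟩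
    set δ := ε / (2 * (|C| + 1) + 1) with hδ
    have hδε : δ * (2 * (|C| + 1) + 1) = ε := div_mul_cancel₀ _ (by positivity)
    have hδ0 : 0 < δ := by positivity
    let M := max N (s.sup id + 1)
    have hsM : s ⊆ Finset.range M := fun j hj => by
      have := Finset.le_sup (f := id) hj
      simp only [id] at this
      simp only [Finset.mem_range, M]
      omega
    let z : ℕ → E := fun j => if j < N then 0 else y j
    have hz : ∀ j, z j ∈ Submodule.span ℝ (u '' Set.Ico (n j) (n (j + 1))) := by
      intro j
      simp only [z]
      split_ifs
      · exact Submodule.zero_mem _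
      · exact hy j
    have key : ∀ t : Finset ℕ, Finset.range N ⊆ t →
        ∑ j ∈ t, z j = ∑ j ∈ t, y j - ∑ j ∈ Finset.range N, y j := by
      intro t ht
      rw [eq_sub_iff_add_eq, ← Finset.sum_sdiff ht, ← Finset.sum_sdiff (f := y) ht]
      have h1 : ∑ j ∈ Finset.range N, z j = 0 :=
        Finset.sum_eq_zero fun j hj => by simp [z, Finset.mem_range.1 hj]
      rw [h1, add_zero]
      congr 1
      refine Finset.sum_congr rfl fun j hj => ?_
      have := (Finset.mem_sdiff.1 hj).2
      simp only [Finset.mem_range] at this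
      simp [z, this]
    have h1 := hC z hz M s hsM
    rw [key s hs, key _ (by simp [M])] at h1
    have h2 := hN M (le_max_left _ _)
    have h3 := hN N le_rfl
    rw [dist_eq_norm] at h2 h3 ⊢
    have h4 : ‖∑ j ∈ Finset.range M, y j - ∑ j ∈ Finset.range N, y j‖ ≤ 2 * δ := by
      have : ∑ j ∈ Finset.range M, y j - ∑ j ∈ Finset.range N, y j
        = (∑ j ∈ Finset.range M, y j - x) - (∑ j ∈ Finset.range N, y j - x) := by abel
      rw [this]
      refine (norm_sub_le _ _).trans ?_
      linarith
    have h5 : ∑ j ∈ s, y j - x = (∑ j ∈ s, y j - ∑ j ∈ Finset.range N, y j)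
        + (∑ j ∈ Finset.range N, y j - x) := by abel
    rw [h5]
    refine (norm_add_le _ _).trans_lt ?_
    have h6 : C * ‖∑ j ∈ Finset.range M, y j - ∑ j ∈ Finset.range N, y j‖
        ≤ (|C| + 1) * (2 * δ) := by
      refine mul_le_mul ?_ h4 (norm_nonneg _) hC0.le
      linarith [le_abs_self C]
    nlinarith

end HasBasisConstant

end BasicSequences

/-! ### A weighted dyadic tree of sums -/

section Tree

/-- Convexity of `|·| ^ q`, in the form of a contraction with a remainder. -/
lemma exists_abs_mul_add_rpow_le {q τ : ℝ} (hq : 1 ≤ q) (hτ : 0 < τ) (hτ1 : τ < 1) :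
    ∃ C : ℝ, 0 < C ∧ ∀ x w : ℝ, |τ * (x + w)| ^ q ≤ τ * |x| ^ q + C * |w| ^ q := by
  have h1 : 0 < 1 - τ := by linarith
  refine ⟨(1 - τ) * (τ / (1 - τ)) ^ q, by positivity, fun x w => ?_⟩
  have h2 : |τ * (x + w)| ≤ τ * |x| + (1 - τ) * (τ / (1 - τ) * |w|) := by
    rw [abs_mul, abs_of_pos hτ, ← mul_assoc, mul_div_cancel₀ _ h1.ne', ← mul_add]
    exact mul_le_mul_of_nonneg_left (abs_add_le _ _) hτ.le
  refine (Real.rpow_le_rpow (abs_nonneg _) h2 (by linarith)).trans ?_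
  have h3 := (convexOn_rpow hq).2 (x := |x|) (Set.mem_Ici.2 (abs_nonneg x))
    (y := τ / (1 - τ) * |w|) (Set.mem_Ici.2 (by positivity)) hτ.le h1.le (by ring)
  simp only [smul_eq_mul] at h3
  refine h3.trans (le_of_eq ?_)
  rw [Real.mul_rpow (by positivity) (abs_nonneg _), mul_assoc]

/-- The sum over the inner vertices `v` of the binary tree of depth `L` of `|w_v| ^ q`, where `w_v`
is `ρ ^ h`, `h` being the height of `v`, times the difference of the sums of `a` over the leaves
below the two children of `v`. The leaves are numbered by `i < 2 ^ L`. -/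
noncomputable def treeSum (q ρ : ℝ) : ℕ → (ℕ → ℝ) → ℝ
  | 0, _ => 0
  | L + 1, a => treeSum q ρ L a + treeSum q ρ L (fun i => a (2 ^ L + i)) +
      |ρ ^ (L + 1) * (∑ i ∈ Finset.range (2 ^ L), a i -
        ∑ i ∈ Finset.range (2 ^ L), a (2 ^ L + i))| ^ q

variable {q ρ : ℝ}

lemma treeSum_nonneg (L : ℕ) (a : ℕ → ℝ) : 0 ≤ treeSum q ρ L a := by
  induction L generalizing a with
  | zero => simp [treeSum]
  | succ L ih =>
    simp only [treeSum]
    have := ih a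
    have := ih (fun i => a (2 ^ L + i))
    positivity

lemma treeSum_congr (L : ℕ) {a b : ℕ → ℝ} (h : ∀ i < 2 ^ L, a i = b i) :
    treeSum q ρ L a = treeSum q ρ L b := by
  induction L generalizing a b with
  | zero => simp [treeSum]
  | succ L ih =>
    have h1 : ∀ i < 2 ^ L, a i = b i := fun i hi => h i (by rw [pow_succ]; omega)
    have h2 : ∀ i < 2 ^ L, a (2 ^ L + i) = b (2 ^ L + i) :=
      fun i hi => h _ (by rw [pow_succ]; omega)
    simp only [treeSum]
    rw [ih h1, ih h2, Finset.sum_congr rfl fun i hi => h1 i (Finset.mem_range.1 hi),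
      Finset.sum_congr rfl fun i hi => h2 i (Finset.mem_range.1 hi)]

lemma treeSum_const (hq : 0 < q) (L : ℕ) (c : ℝ) : treeSum q ρ L (fun _ => c) = 0 := by
  induction L with
  | zero => simp [treeSum]
  | succ L ih => simp [treeSum, ih, Real.zero_rpow hq.ne']

lemma treeSum_eq_zero (hq : 0 < q) (L : ℕ) {a : ℕ → ℝ} (h : ∀ i < 2 ^ L, a i = 0) :
    treeSum q ρ L a = 0 := by
  rw [treeSum_congr L h, treeSum_const hq]

lemma sum_range_two_pow_succ (L : ℕ) (a : ℕ → ℝ) :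
    ∑ i ∈ Finset.range (2 ^ (L + 1)), a i = ∑ i ∈ Finset.range (2 ^ L), a i +
      ∑ i ∈ Finset.range (2 ^ L), a (2 ^ L + i) := by
  rw [pow_succ, mul_two, Finset.sum_range_add]

/-- Truncation of the sequence of leaves is bounded, with respect to the sum of `treeSum` and the
root term `|ρ ^ L * ∑ a| ^ q`, uniformly in the depth. With `β_v` the weighted sum below a vertex,
`ρ < 1` makes the contribution of a vertex to its ancestors decay, and `1 / 2 < ρ` makes
`β_{child} = (β_v ± w_v) / (2 ρ)` decay from the root to the leaves. -/
theorem exists_treeSum_truncate_le (hq : 1 ≤ q) (hρ : 1 / 2 < ρ) (hρ1 : ρ < 1) :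
    ∃ A : ℝ, 1 ≤ A ∧ ∀ (L : ℕ) (a : ℕ → ℝ) (m : ℕ), m ≤ 2 ^ L →
      treeSum q ρ L (fun i => if i < m then a i else 0) +
        |ρ ^ L * ∑ i ∈ Finset.range (2 ^ L), if i < m then a i else 0| ^ q ≤
      A * (treeSum q ρ L a + |ρ ^ L * ∑ i ∈ Finset.range (2 ^ L), a i| ^ q) := by
  have hρ0 : 0 < ρ := by linarith
  have hq0 : 0 < q := by linarith
  obtain ⟨C', hC', hup⟩ := exists_abs_mul_add_rpow_le hq hρ0 hρ1
  set τ := 1 / (2 * ρ) with hτdef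
  have hτ0 : 0 < τ := by positivity
  have hτ1 : τ < 1 := by rw [hτdef, div_lt_one (by positivity)]; linarith
  obtain ⟨C, hC, hdown⟩ := exists_abs_mul_add_rpow_le hq hτ0 hτ1
  have hρ1' : 0 < 1 - ρ := by linarith
  have hτ1' : 0 < 1 - τ := by linarith
  set l := ρ / (1 - ρ) with hl
  have hl0 : 0 < l := by positivity
  have hlρ : (1 + l) * ρ = l := by rw [hl]; field_simp; ring
  set μ := 1 / (2 * C) with hμ
  have hμ0 : 0 < μ := by positivity
  have hμC : μ * C = 1 / 2 := by rw [hμ]; field_simp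
  set D := (1 + l) * C' with hD
  have hD0 : 0 < D := by positivity
  set K := 1 + l / μ + 2 * D * C + D * τ / (μ * (1 - τ)) with hK
  have hK0 : 0 < K := by positivity
  have hK1 : 1 ≤ K := by
    have : 0 ≤ l / μ + 2 * D * C + D * τ / (μ * (1 - τ)) := by positivity
    rw [hK]; linarith
  have hKl : l ≤ K * μ := by
    rw [← div_le_iff₀ hμ0, hK]
    have : 0 ≤ 2 * D * C + D * τ / (μ * (1 - τ)) := by positivity
    linarith
  have hK3 : 2 * D * C ≤ K := by
    rw [hK]
    have : 0 ≤ l / μ + D * τ / (μ * (1 - τ)) := by positivity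
    linarith
  have hK4 : D * τ ≤ K * (μ * (1 - τ)) := by
    rw [← div_le_iff₀ (by positivity), hK]
    have : 0 ≤ l / μ + 2 * D * C := by positivity
    linarith
  -- the inequality that is stable under joining two trees at a new root
  have main : ∀ (L : ℕ) (a : ℕ → ℝ) (m : ℕ), m ≤ 2 ^ L →
      treeSum q ρ L (fun i => if i < m then a i else 0) +
        l * |ρ ^ L * ∑ i ∈ Finset.range (2 ^ L), if i < m then a i else 0| ^ q ≤
      K * (treeSum q ρ L a + μ * |ρ ^ L * ∑ i ∈ Finset.range (2 ^ L), a i| ^ q) := by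
    intro L
    induction L with
    | zero =>
      intro a m hm
      simp only [treeSum, pow_zero, Finset.range_one, Finset.sum_singleton, zero_add, one_mul]
      rw [← mul_assoc]
      split_ifs
      · exact mul_le_mul_of_nonneg_right hKl (by positivity)
      · rw [abs_zero, Real.zero_rpow hq0.ne', mul_zero]
        positivity
    | succ L ih =>
      intro a m hm
      rw [sum_range_two_pow_succ, sum_range_two_pow_succ]
      simp only [treeSum]
      set Sl := ∑ i ∈ Finset.range (2 ^ L), a i with hSl
      set Sr := ∑ i ∈ Finset.range (2 ^ L), a (2 ^ L + i) with hSr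
      set w := ρ ^ (L + 1) * (Sl - Sr) with hw
      set β := ρ ^ (L + 1) * (Sl + Sr) with hβ
      have hl1 : ρ ^ L * Sl = τ * (β + w) := by
        rw [hβ, hw, hτdef, pow_succ]; field_simp; ring
      have hr1 : ρ ^ L * Sr = τ * (β + -w) := by
        rw [hβ, hw, hτdef, pow_succ]; field_simp; ring
      have hl2 : |ρ ^ L * Sl| ^ q ≤ τ * |β| ^ q + C * |w| ^ q := by rw [hl1]; exact hdown _ _
      have hr2 : |ρ ^ L * Sr| ^ q ≤ τ * |β| ^ q + C * |w| ^ q := by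
        rw [hr1]; refine (hdown _ _).trans ?_; rw [abs_neg]
      have hTl := treeSum_nonneg (q := q) (ρ := ρ) L a
      have hTr := treeSum_nonneg (q := q) (ρ := ρ) L (fun i => a (2 ^ L + i))
      have hβ0 : 0 ≤ |β| ^ q := by positivity
      have hw0 : 0 ≤ |w| ^ q := by positivity
      rcases le_total m (2 ^ L) with hmL | hmL
      · have e1 : ∀ i < 2 ^ L, (if 2 ^ L + i < m then a (2 ^ L + i) else 0) = 0 := by
          intro i _; rw [if_neg (by omega)]
        have e2 : ∑ i ∈ Finset.range (2 ^ L), (if 2 ^ L + i < m then a (2 ^ L + i) else 0) = 0 :=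
          Finset.sum_eq_zero fun i hi => e1 i (Finset.mem_range.1 hi)
        rw [treeSum_eq_zero hq0 L e1, e2, add_zero, add_zero, sub_zero]
        have ihl := ih a m hmL
        set S' := ∑ i ∈ Finset.range (2 ^ L), if i < m then a i else 0 with hS'
        have h1 : |ρ ^ (L + 1) * S'| ^ q ≤ ρ * |ρ ^ L * S'| ^ q := by
          have := hup (ρ ^ L * S') 0
          rw [add_zero, abs_zero, Real.zero_rpow hq0.ne', mul_zero, add_zero] at this
          rwa [pow_succ, mul_comm (ρ ^ L), mul_assoc]
        have h2 : (1 + l) * |ρ ^ (L + 1) * S'| ^ q ≤ l * |ρ ^ L * S'| ^ q := by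
          calc _ ≤ (1 + l) * (ρ * |ρ ^ L * S'| ^ q) :=
                mul_le_mul_of_nonneg_left h1 (by positivity)
            _ = _ := by rw [← mul_assoc, hlρ]
        have h3 : μ * |ρ ^ L * Sl| ^ q ≤ μ * |β| ^ q + |w| ^ q := by
          have := mul_le_mul_of_nonneg_left hl2 hμ0.le
          have e : μ * (τ * |β| ^ q + C * |w| ^ q) = τ * (μ * |β| ^ q) + (μ * C) * |w| ^ q := by
            ring
          rw [e, hμC] at this
          have : τ * (μ * |β| ^ q) ≤ 1 * (μ * |β| ^ q) :=
            mul_le_mul_of_nonneg_right hτ1.le (by positivity)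
          linarith
        have h4 : K * (treeSum q ρ L a + μ * |ρ ^ L * Sl| ^ q) ≤
            K * (treeSum q ρ L a + treeSum q ρ L (fun i => a (2 ^ L + i)) + |w| ^ q
              + μ * |β| ^ q) :=
          mul_le_mul_of_nonneg_left (by linarith) hK0.le
        linarith
      · have e1 : ∀ i < 2 ^ L, (if i < m then a i else 0) = a i := by
          intro i hi; rw [if_pos (by omega)]
        have e2 : ∑ i ∈ Finset.range (2 ^ L), (if i < m then a i else 0) = Sl :=
          Finset.sum_congr rfl fun i hi => e1 i (Finset.mem_range.1 hi)
        have e3 : (fun i => if 2 ^ L + i < m then a (2 ^ L + i) else 0)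
            = fun i => if i < m - 2 ^ L then a (2 ^ L + i) else 0 := by
          funext i
          congr 1
          exact propext (by omega)
        rw [treeSum_congr L e1, e2, e3]
        have ihr := ih (fun i => a (2 ^ L + i)) (m - 2 ^ L) (by rw [pow_succ] at hm; omega)
        rw [← hSr] at ihr
        set S' := ∑ i ∈ Finset.range (2 ^ L), if i < m - 2 ^ L then a (2 ^ L + i) else 0 with hS'
        have h1 : |ρ ^ (L + 1) * (Sl - S')| ^ q ≤ ρ * |ρ ^ L * S'| ^ q + C' * |ρ ^ L * Sl| ^ q := by
          have := hup (ρ ^ L * S') (-(ρ ^ L * Sl))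
          rw [abs_neg] at this
          refine le_trans (le_of_eq ?_) this
          rw [← abs_neg]; congr 2; rw [pow_succ]; ring
        have h2 : |ρ ^ (L + 1) * (Sl + S')| ^ q ≤ ρ * |ρ ^ L * S'| ^ q + C' * |ρ ^ L * Sl| ^ q := by
          have := hup (ρ ^ L * S') (ρ ^ L * Sl)
          refine le_trans (le_of_eq ?_) this
          congr 2; rw [pow_succ]; ring
        have h3 : |ρ ^ (L + 1) * (Sl - S')| ^ q + l * |ρ ^ (L + 1) * (Sl + S')| ^ q
            ≤ l * |ρ ^ L * S'| ^ q + D * |ρ ^ L * Sl| ^ q := by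
          have h4 := mul_le_mul_of_nonneg_left h2 hl0.le
          have h5 : (1 + l) * (ρ * |ρ ^ L * S'| ^ q + C' * |ρ ^ L * Sl| ^ q)
              = l * |ρ ^ L * S'| ^ q + D * |ρ ^ L * Sl| ^ q := by
            rw [hD]
            linear_combination |ρ ^ L * S'| ^ q * hlρ
          linarith
        have h6 : K * (μ * |ρ ^ L * Sr| ^ q) + D * |ρ ^ L * Sl| ^ q
            ≤ K * (|w| ^ q + μ * |β| ^ q) := by
          have a1 := mul_le_mul_of_nonneg_left hr2 (mul_pos hK0 hμ0).le
          have a2 := mul_le_mul_of_nonneg_left hl2 hD0.le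
          have a3 := mul_le_mul_of_nonneg_right hK4 hβ0
          have a4 := mul_le_mul_of_nonneg_right hK3 hw0
          have a5 : K * μ * C * |w| ^ q = K * (1 / 2) * |w| ^ q := by
            rw [mul_assoc K, hμC]
          linarith
        have h7 : treeSum q ρ L a ≤ K * treeSum q ρ L a := le_mul_of_one_le_left hTl hK1
        linarith
  refine ⟨K * max 1 μ / min 1 l, ?_, fun L a m hm => ?_⟩
  · rw [le_div_iff₀ (by positivity), one_mul]
    exact (min_le_left _ _).trans (hK1.trans (le_mul_of_one_le_right hK0.le (le_max_left _ _)))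
  · have h := main L a m hm
    set T' := treeSum q ρ L (fun i => if i < m then a i else 0)
    set B' := |ρ ^ L * ∑ i ∈ Finset.range (2 ^ L), if i < m then a i else 0| ^ q
    set T := treeSum q ρ L a with hT
    set B := |ρ ^ L * ∑ i ∈ Finset.range (2 ^ L), a i| ^ q
    have hT' : 0 ≤ T' := treeSum_nonneg _ _
    have hTn : 0 ≤ T := treeSum_nonneg _ _
    have hB' : 0 ≤ B' := by positivity
    have hB : 0 ≤ B := by positivity
    rw [div_mul_eq_mul_div, le_div_iff₀ (by positivity)]
    have h1 : min 1 l * T' ≤ 1 * T' := mul_le_mul_of_nonneg_right (min_le_left _ _) hT'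
    have h2 : min 1 l * B' ≤ l * B' := mul_le_mul_of_nonneg_right (min_le_right _ _) hB'
    have h3 : 1 * T ≤ max 1 μ * T := mul_le_mul_of_nonneg_right (le_max_left _ _) hTn
    have h4 : μ * B ≤ max 1 μ * B := mul_le_mul_of_nonneg_right (le_max_right _ _) hB
    have h5 : K * (T + μ * B) ≤ K * (max 1 μ * T + max 1 μ * B) :=
      mul_le_mul_of_nonneg_left (by linarith) hK0.le
    linarith

end Tree

/-! ### Sequences whose norm is given by a tree in each dyadic block -/

section TreeNorm

lemma sum_range_two_pow_sub_one {M : Type*} [AddCommMonoid M] (F : ℕ → M) (N : ℕ) :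
    ∑ i ∈ Finset.range (2 ^ N - 1), F i =
      ∑ n ∈ Finset.range N, ∑ i ∈ Finset.range (2 ^ n), F (2 ^ n - 1 + i) := by
  induction N with
  | zero => simp
  | succ N ih =>
    have h : 2 ^ (N + 1) - 1 = (2 ^ N - 1) + 2 ^ N := by
      have := Nat.one_le_two_pow (n := N)
      rw [pow_succ]; omega
    rw [h, Finset.sum_range_add, ih, Finset.sum_range_succ]

lemma log_two_pow_sub_one_add {n i : ℕ} (hi : i < 2 ^ n) : Nat.log 2 (2 ^ n - 1 + i + 1) = n := by
  have := Nat.one_le_two_pow (n := n)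
  refine (Nat.log_eq_iff (Or.inr ⟨by norm_num, by omega⟩)).2 ⟨by omega, ?_⟩
  rw [pow_succ]; omega

variable {E : Type*} [NormedAddCommGroup E] [NormedSpace ℝ E]

/-- The norm of a combination of the sequence `u`, cut into the dyadic blocks
`[2 ^ n - 1, 2 ^ (n + 1) - 1)`, is equivalent to that of `∑ n, c n * ρ ^ n * S_n • h n`, where `S_n`
is the sum of the coefficients in the block, together with the trees of the blocks and a weighted
`ℓ_q` norm of the coefficients. -/
def HasTreeNorm (q ρ : ℝ) (c R : ℕ → ℝ) (h u : ℕ → E) : Prop :=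
  ∀ (a : ℕ → ℝ) (N : ℕ), ‖∑ i ∈ Finset.range (2 ^ N - 1), a i • u i‖ ^ q =
    ‖∑ n ∈ Finset.range N,
      (c n * (ρ ^ n * ∑ i ∈ Finset.range (2 ^ n), a (2 ^ n - 1 + i))) • h n‖ ^ q +
    ∑ n ∈ Finset.range N, c n ^ q * treeSum q ρ n (fun i => a (2 ^ n - 1 + i)) +
    ∑ i ∈ Finset.range (2 ^ N - 1), |a i| ^ q * R i

/-- The projections onto finite sets of coordinates are bounded by `K` on finite combinations. -/
def HasUnconditionalConstant (h : ℕ → E) (K : ℝ) : Prop :=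
  ∀ (b : ℕ → ℝ) (N : ℕ) (A : Finset ℕ), A ⊆ Finset.range N →
    ‖∑ n ∈ A, b n • h n‖ ≤ K * ‖∑ n ∈ Finset.range N, b n • h n‖

lemma HasUnconditionalConstant.hasBasisConstant {h : ℕ → E} {K : ℝ}
    (hh : HasUnconditionalConstant h K) : HasBasisConstant h K :=
  fun a n m hnm => hh a m (Finset.range n) (by simpa using hnm)

variable {q ρ K : ℝ} {c R : ℕ → ℝ} {h u : ℕ → E}

lemma le_rpow_mul_of_rpow_le {x y G q : ℝ} (hq : 0 < q) (hx : 0 ≤ x) (hy : 0 ≤ y) (hG : 0 ≤ G)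
    (hxy : x ^ q ≤ G * y ^ q) : x ≤ G ^ (1 / q) * y := by
  have h1 : (G ^ (1 / q) * y) ^ q = G * y ^ q := by
    rw [Real.mul_rpow (by positivity) hy, ← Real.rpow_mul hG, one_div_mul_cancel hq.ne',
      Real.rpow_one]
  rw [← h1] at hxy
  exact (Real.rpow_le_rpow_iff hx (by positivity) hq).1 hxy

lemma real_add_rpow_le {x y q : ℝ} (hx : 0 ≤ x) (hy : 0 ≤ y) (hq : 1 ≤ q) :
    (x + y) ^ q ≤ 2 ^ (q - 1) * (x ^ q + y ^ q) := by
  lift x to NNReal using hx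
  lift y to NNReal using hy
  exact_mod_cast NNReal.rpow_add_le_mul_rpow_add_rpow x y hq

namespace HasTreeNorm

theorem exists_hasBasisConstant (hu : HasTreeNorm q ρ c R h u) (hq : 1 ≤ q) (hρ : 1 / 2 < ρ)
    (hρ1 : ρ < 1) (hc : ∀ n, 0 ≤ c n) (hR : ∀ i, 0 ≤ R i) (hK : 1 ≤ K)
    (hh : HasUnconditionalConstant h K) (hh1 : ∀ n, ‖h n‖ = 1) :
    ∃ K', HasBasisConstant u K' := by
  have hq0 : 0 < q := by linarith
  obtain ⟨A, hA1, hA⟩ := exists_treeSum_truncate_le hq hρ hρ1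
  have hA0 : 0 ≤ A := by linarith
  have hK0 : 0 ≤ K := by linarith
  set D : ℝ := 2 ^ (q - 1) with hD
  have hD1 : 1 ≤ D := Real.one_le_rpow (by norm_num) (by linarith)
  set κ := K ^ q with hκ
  have hκ1 : 1 ≤ κ := Real.one_le_rpow hK hq0.le
  set G := D * (κ + A * (1 + κ)) + 1 with hG
  have hG1 : 1 ≤ G := by
    have : 0 ≤ D * (κ + A * (1 + κ)) := by positivity
    rw [hG]; linarith
  have main : ∀ (a : ℕ → ℝ) (m N : ℕ),
      ‖∑ i ∈ Finset.range (2 ^ N - 1), (if i < m then a i else 0) • u i‖ ^ q ≤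
        G * ‖∑ i ∈ Finset.range (2 ^ N - 1), a i • u i‖ ^ q := by
    intro a m N
    rcases le_or_gt (2 ^ N - 1) m with hm | hm
    · have : ∑ i ∈ Finset.range (2 ^ N - 1), (if i < m then a i else 0) • u i
          = ∑ i ∈ Finset.range (2 ^ N - 1), a i • u i :=
        Finset.sum_congr rfl fun i hi => by
          rw [if_pos (lt_of_lt_of_le (Finset.mem_range.1 hi) hm)]
      rw [this]
      exact le_mul_of_one_le_left (by positivity) hG1
    -- the truncation happens inside the block `n₀`
    set n₀ := Nat.log 2 (m + 1) with hn₀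
    have hlo : 2 ^ n₀ ≤ m + 1 := Nat.pow_log_le_self 2 (by omega)
    have hhi : m + 1 < 2 ^ (n₀ + 1) := Nat.lt_pow_succ_log_self (by norm_num) _
    have hn₀N : n₀ < N := by
      by_contra hcon
      have := Nat.pow_le_pow_right (n := 2) (by norm_num) (not_lt.1 hcon)
      omega
    rw [hu, hu]
    set a' : ℕ → ℝ := fun i => if i < m then a i else 0 with ha'
    have hlt : ∀ n < n₀, ∀ i < 2 ^ n, a' (2 ^ n - 1 + i) = a (2 ^ n - 1 + i) := by
      intro n hn i hi
      have := Nat.pow_le_pow_right (n := 2) (by norm_num) (Nat.succ_le_of_lt hn)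
      rw [Nat.succ_eq_add_one, pow_succ] at this
      simp only [ha']
      rw [if_pos (by omega)]
    have hgt : ∀ n, n₀ < n → ∀ i < 2 ^ n, a' (2 ^ n - 1 + i) = 0 := by
      intro n hn i hi
      have := Nat.pow_le_pow_right (n := 2) (by norm_num) (Nat.succ_le_of_lt hn)
      rw [Nat.succ_eq_add_one] at this
      simp only [ha']
      rw [if_neg (by omega)]
    have heq : ∀ i, a' (2 ^ n₀ - 1 + i) = if i < m + 1 - 2 ^ n₀ then a (2 ^ n₀ - 1 + i) else 0 := by
      intro i
      simp only [ha']
      have h1 := Nat.one_le_two_pow (n := n₀)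
      congr 1
      exact propext (by omega)
    set B : ℕ → ℝ := fun n => c n * (ρ ^ n * ∑ i ∈ Finset.range (2 ^ n), a (2 ^ n - 1 + i)) with hB
    set B' : ℕ → ℝ :=
      fun n => c n * (ρ ^ n * ∑ i ∈ Finset.range (2 ^ n), a' (2 ^ n - 1 + i)) with hB'
    have hBlt : ∀ n < n₀, B' n = B n := fun n hn => by
      simp only [hB, hB']
      rw [Finset.sum_congr rfl fun i hi => hlt n hn i (Finset.mem_range.1 hi)]
    have hBgt : ∀ n, n₀ < n → B' n = 0 := fun n hn => by
      simp only [hB']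
      rw [Finset.sum_eq_zero fun i hi => hgt n hn i (Finset.mem_range.1 hi), mul_zero, mul_zero]
    set t : ℕ → ℝ := fun n => c n ^ q * treeSum q ρ n (fun i => a (2 ^ n - 1 + i)) with ht
    set t' : ℕ → ℝ := fun n => c n ^ q * treeSum q ρ n (fun i => a' (2 ^ n - 1 + i)) with ht'
    have ht0 : ∀ n, 0 ≤ t n := fun n =>
      mul_nonneg (Real.rpow_nonneg (hc n) _) (treeSum_nonneg _ _)
    set H := ‖∑ n ∈ Finset.range N, B n • h n‖ with hH
    have hBH : ∀ n < N, |B n| ≤ K * H := by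
      intro n hn
      have := hh B N {n} (by simpa using hn)
      simpa [norm_smul, hh1] using this
    have hnode : |B' n₀| ^ q + t' n₀ ≤ A * (t n₀ + |B n₀| ^ q) := by
      have h1 := hA n₀ (fun i => a (2 ^ n₀ - 1 + i)) (m + 1 - 2 ^ n₀)
        (by rw [pow_succ] at hhi; omega)
      have h2 := mul_le_mul_of_nonneg_left h1 (Real.rpow_nonneg (hc n₀) q)
      simp only [hB, hB', ht, ht', heq]
      rw [abs_mul (c n₀), abs_mul (c n₀), abs_of_nonneg (hc n₀), Real.mul_rpow (hc n₀) (abs_nonneg _),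
        Real.mul_rpow (hc n₀) (abs_nonneg _)]
      linarith
    have hBq : |B n₀| ^ q ≤ κ * H ^ q := by
      rw [hκ, ← Real.mul_rpow hK0 (norm_nonneg _)]
      exact Real.rpow_le_rpow (abs_nonneg _) (hBH n₀ hn₀N) hq0.le
    have htsum : t n₀ ≤ ∑ n ∈ Finset.range N, t n :=
      Finset.single_le_sum (fun n _ => ht0 n) (Finset.mem_range.2 hn₀N)
    have ht'sum : ∑ n ∈ Finset.range N, t' n ≤ ∑ n ∈ Finset.range N, t n + t' n₀ := by
      have h1 : ∀ n ∈ Finset.range N, t' n ≤ t n + if n = n₀ then t' n else 0 := by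
        intro n _
        rcases lt_trichotomy n n₀ with h1 | h1 | h1
        · simp only [ht', ht, treeSum_congr n (hlt n h1), if_neg h1.ne]
          linarith
        · rw [if_pos h1]
          linarith [ht0 n]
        · have : t' n = 0 := by simp only [ht', treeSum_eq_zero hq0 n (hgt n h1), mul_zero]
          rw [if_neg h1.ne', this]
          linarith [ht0 n]
      refine (Finset.sum_le_sum h1).trans (le_of_eq ?_)
      rw [Finset.sum_add_distrib, Finset.sum_ite_eq', if_pos (Finset.mem_range.2 hn₀N)]
    have hH' : ‖∑ n ∈ Finset.range N, B' n • h n‖ ^ q ≤ D * (κ * H ^ q + |B' n₀| ^ q) := by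
      have e1 : ∑ n ∈ Finset.range N, B' n • h n
          = ∑ n ∈ Finset.range n₀, B n • h n + B' n₀ • h n₀ := by
        have e2 : ∑ n ∈ Finset.range n₀, B n • h n = ∑ n ∈ Finset.range n₀, B' n • h n :=
          Finset.sum_congr rfl fun n hn => by rw [hBlt n (Finset.mem_range.1 hn)]
        rw [e2, ← Finset.sum_range_succ]
        symm
        refine Finset.sum_subset (by simpa using hn₀N) fun n _ hn => ?_
        rw [hBgt n (by simp only [Finset.mem_range] at hn; omega), zero_smul]
      have e3 : ‖∑ n ∈ Finset.range N, B' n • h n‖ ≤ K * H + |B' n₀| := by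
        rw [e1]
        refine (norm_add_le _ _).trans (add_le_add ?_ ?_)
        · exact hh B N _ (by simpa using hn₀N.le)
        · rw [norm_smul, hh1, mul_one, Real.norm_eq_abs]
      refine (Real.rpow_le_rpow (norm_nonneg _) e3 hq0.le).trans ?_
      refine (real_add_rpow_le (mul_nonneg hK0 (norm_nonneg _))
        (abs_nonneg _) hq).trans (le_of_eq ?_)
      rw [Real.mul_rpow hK0 (norm_nonneg _)]
    have haR : ∑ i ∈ Finset.range (2 ^ N - 1), |a' i| ^ q * R i
        ≤ ∑ i ∈ Finset.range (2 ^ N - 1), |a i| ^ q * R i := by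
      refine Finset.sum_le_sum fun i _ => mul_le_mul_of_nonneg_right ?_ (hR i)
      simp only [ha']
      split_ifs
      · exact le_rfl
      · rw [abs_zero, Real.zero_rpow hq0.ne']
        positivity
    have hR0 : 0 ≤ ∑ i ∈ Finset.range (2 ^ N - 1), |a i| ^ q * R i :=
      Finset.sum_nonneg fun i _ => mul_nonneg (by positivity) (hR i)
    have hS0 : 0 ≤ ∑ n ∈ Finset.range N, t n := Finset.sum_nonneg fun n _ => ht0 n
    set S := ∑ n ∈ Finset.range N, t n
    set P := ∑ i ∈ Finset.range (2 ^ N - 1), |a i| ^ q * R i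
    have hHq : 0 ≤ H ^ q := by positivity
    have ht'0 : 0 ≤ t' n₀ := mul_nonneg (Real.rpow_nonneg (hc n₀) _) (treeSum_nonneg _ _)
    have f1 : A * (t n₀ + |B n₀| ^ q) ≤ A * (S + κ * H ^ q) :=
      mul_le_mul_of_nonneg_left (by linarith) hA0
    have f2 : D * (κ * H ^ q + |B' n₀| ^ q) + t' n₀ ≤ D * (κ * H ^ q + A * (S + κ * H ^ q)) := by
      have e1 : t' n₀ ≤ D * t' n₀ := le_mul_of_one_le_left ht'0 hD1
      have e2 : D * (|B' n₀| ^ q + t' n₀) ≤ D * (A * (S + κ * H ^ q)) :=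
        mul_le_mul_of_nonneg_left (by linarith) (by linarith)
      linarith
    have f3 : D * (κ * H ^ q + A * (S + κ * H ^ q)) ≤ D * (κ + A * (1 + κ)) * (H ^ q + S) := by
      have e1 : 0 ≤ D * (κ + A * κ) * S := by positivity
      have e2 : 0 ≤ D * A * H ^ q := by positivity
      linarith
    have f4 : D * (κ + A * (1 + κ)) * (H ^ q + S) ≤ (G - 1) * (H ^ q + S) := by
      rw [hG, add_sub_cancel_right]
    have f5 : 0 ≤ (G - 1) * P := mul_nonneg (by linarith) hR0
    linarith
  refine ⟨G ^ (1 / q), fun a n m hnm => ?_⟩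
  have hm : m ≤ 2 ^ m - 1 := by
    have := Nat.lt_two_pow_self (n := m)
    omega
  have h1 := main (fun i => if i < m then a i else 0) n m
  have e1 : ∑ i ∈ Finset.range (2 ^ m - 1), (if i < m then a i else 0) • u i
      = ∑ i ∈ Finset.range m, a i • u i := by
    symm
    refine Finset.sum_subset_zero_on_sdiff (by simpa using hm) (fun i hi => ?_) (fun i hi => ?_)
    · rw [if_neg (by simpa using (Finset.mem_sdiff.1 hi).2), zero_smul]
    · rw [if_pos (by simpa using hi)]
  have e2 : ∑ i ∈ Finset.range (2 ^ m - 1),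
      (if i < n then (if i < m then a i else 0) else 0) • u i
      = ∑ i ∈ Finset.range n, a i • u i := by
    symm
    refine Finset.sum_subset_zero_on_sdiff (by simpa using hnm.trans hm) (fun i hi => ?_)
      (fun i hi => ?_)
    · rw [if_neg (by simpa using (Finset.mem_sdiff.1 hi).2), zero_smul]
    · have : i < n := by simpa using hi
      rw [if_pos this, if_pos (this.trans_le hnm)]
  rw [e1, e2] at h1
  exact le_rpow_mul_of_rpow_le hq0 (norm_nonneg _) (norm_nonneg _) (by linarith) h1

theorem exists_block_bound (hu : HasTreeNorm q ρ c R h u) (hq : 1 ≤ q)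
    (hc : ∀ n, 0 ≤ c n) (hR : ∀ i, 0 ≤ R i) (hK : 1 ≤ K)
    (hh : HasUnconditionalConstant h K) :
    ∃ C : ℝ, ∀ y : ℕ → E,
      (∀ j, y j ∈ Submodule.span ℝ (u '' Set.Ico (2 ^ j - 1) (2 ^ (j + 1) - 1))) →
      ∀ (N : ℕ) (A : Finset ℕ), A ⊆ Finset.range N →
        ‖∑ j ∈ A, y j‖ ≤ C * ‖∑ j ∈ Finset.range N, y j‖ := by
  have hq0 : 0 < q := by linarith
  have hK0 : 0 ≤ K := by linarith
  refine ⟨(K ^ q) ^ (1 / q), fun y hy N A hAN => ?_⟩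
  have hco : ∀ j, ∃ b : ℕ → ℝ, y j = ∑ i ∈ Finset.range (2 ^ j), b i • u (2 ^ j - 1 + i) := by
    intro j
    have hj := hy j
    have hset : Set.Ico (2 ^ j - 1) (2 ^ (j + 1) - 1) =
        ((Finset.range (2 ^ j)).image (fun i => 2 ^ j - 1 + i) : Finset ℕ) := by
      ext i
      simp only [Set.mem_Ico, Finset.coe_image, Set.mem_image, Finset.mem_coe, Finset.mem_range]
      have := Nat.one_le_two_pow (n := j)
      rw [pow_succ]
      constructor
      · intro hi
        exact ⟨i - (2 ^ j - 1), by omega, by omega⟩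
      · rintro ⟨k, hk, rfl⟩
        omega
    rw [hset] at hj
    obtain ⟨b, hb⟩ := (Submodule.mem_span_image_finset_iff_exists_fun' ℝ).1 hj
    refine ⟨fun i => b (2 ^ j - 1 + i), ?_⟩
    rw [← hb, Finset.sum_image (by intro x _ y _ hxy; simpa using hxy)]
  choose b hb using hco
  -- the coefficients of the whole sequence, and their restriction to the blocks in a set
  let a : ℕ → ℝ := fun i => b (Nat.log 2 (i + 1)) (i + 1 - 2 ^ Nat.log 2 (i + 1))
  have ha : ∀ n i, i < 2 ^ n → a (2 ^ n - 1 + i) = b n i := by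
    intro n i hi
    have := Nat.one_le_two_pow (n := n)
    simp only [a, log_two_pow_sub_one_add hi]
    congr 1
    omega
  let r : Finset ℕ → ℕ → ℝ := fun s i => if Nat.log 2 (i + 1) ∈ s then a i else 0
  have hr : ∀ (s : Finset ℕ) n i, i < 2 ^ n → r s (2 ^ n - 1 + i) = if n ∈ s then b n i else 0 := by
    intro s n i hi
    simp only [r, log_two_pow_sub_one_add hi, ha n i hi]
  have hsum : ∀ s ⊆ Finset.range N, ∑ i ∈ Finset.range (2 ^ N - 1), r s i • u i
      = ∑ j ∈ s, y j := by
    intro s hs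
    rw [sum_range_two_pow_sub_one]
    symm
    refine Finset.sum_subset_zero_on_sdiff hs (fun n hn => ?_) (fun n hn => ?_)
    · refine Finset.sum_eq_zero fun i hi => ?_
      rw [hr s n i (Finset.mem_range.1 hi), if_neg (Finset.mem_sdiff.1 hn).2, zero_smul]
    · rw [hb n]
      refine Finset.sum_congr rfl fun i hi => ?_
      rw [hr s n i (Finset.mem_range.1 hi), if_pos hn]
  rw [← hsum A hAN, ← hsum _ subset_rfl]
  refine le_rpow_mul_of_rpow_le hq0 (norm_nonneg _) (norm_nonneg _) (by positivity) ?_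
  rw [hu, hu, mul_add, mul_add]
  have hκ1 : 1 ≤ K ^ q := Real.one_le_rpow hK hq0.le
  have hrn : ∀ n ∈ Finset.range N, ∀ i < 2 ^ n, r (Finset.range N) (2 ^ n - 1 + i) = b n i :=
    fun n hn i hi => by rw [hr _ n i hi, if_pos hn]
  refine add_le_add (add_le_add ?_ ?_) ?_
  · rw [← Real.mul_rpow hK0 (norm_nonneg _)]
    refine Real.rpow_le_rpow (norm_nonneg _) ?_ hq0.le
    refine le_trans (le_of_eq ?_) (hh _ N A hAN)
    congr 1
    symm
    refine Finset.sum_subset_zero_on_sdiff hAN (fun n hn => ?_) (fun n hn => ?_)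
    · rw [Finset.sum_eq_zero fun i hi => by
        rw [hr A n i (Finset.mem_range.1 hi), if_neg (Finset.mem_sdiff.1 hn).2]]
      simp
    · congr 3
      refine Finset.sum_congr rfl fun i hi => ?_
      rw [hr A n i (Finset.mem_range.1 hi), if_pos hn,
        hrn n (hAN hn) i (Finset.mem_range.1 hi)]
  · rw [Finset.mul_sum]
    refine Finset.sum_le_sum fun n hn => ?_
    have h0 : ∀ s : Finset ℕ, 0 ≤ c n ^ q * treeSum q ρ n (fun i => r s (2 ^ n - 1 + i)) :=
      fun s => mul_nonneg (Real.rpow_nonneg (hc n) _) (treeSum_nonneg _ _)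
    refine le_trans ?_ (le_mul_of_one_le_left (h0 _) hκ1)
    by_cases hnA : n ∈ A
    · rw [treeSum_congr n (b := fun i => r (Finset.range N) (2 ^ n - 1 + i)) fun i hi => by
        rw [hr A n i hi, if_pos hnA, hrn n hn i hi]]
    · rw [treeSum_eq_zero hq0 n fun i hi => by rw [hr A n i hi, if_neg hnA], mul_zero]
      exact h0 _
  · rw [Finset.mul_sum]
    refine Finset.sum_le_sum fun i hi => ?_
    have h0 : 0 ≤ |r (Finset.range N) i| ^ q * R i := mul_nonneg (by positivity) (hR i)
    refine le_trans (mul_le_mul_of_nonneg_right ?_ (hR i)) (le_mul_of_one_le_left h0 hκ1)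
    refine Real.rpow_le_rpow (abs_nonneg _) ?_ hq0.le
    simp only [r]
    by_cases hiA : Nat.log 2 (i + 1) ∈ A
    · rw [if_pos hiA, if_pos (hAN hiA)]
    · rw [if_neg hiA, abs_zero]
      exact abs_nonneg _

end HasTreeNorm

end TreeNorm

/-! ### Functions with disjoint supports -/

section LpSupp

lemma Lp_norm_rpow_eq_integral {α : Type*} [MeasurableSpace α] {μ : Measure α} {p : ℝ≥0∞}
    (hp0 : p ≠ 0) (hp : p ≠ ∞) (f : Lp ℝ p μ) :
    ‖f‖ ^ p.toReal = ∫ x, |f x| ^ p.toReal ∂μ := by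
  have hq : 0 < p.toReal := ENNReal.toReal_pos hp0 hp
  rw [Lp.norm_def, (Lp.memLp f).eLpNorm_eq_integral_rpow_norm hp0 hp, ENNReal.toReal_ofReal,
    ← Real.rpow_mul, inv_mul_cancel₀ hq.ne', Real.rpow_one]
  · rfl
  all_goals positivity

lemma Lp_integrable_rpow {α : Type*} [MeasurableSpace α] {μ : Measure α} {p : ℝ≥0∞}
    (hp0 : p ≠ 0) (hp : p ≠ ∞) (f : Lp ℝ p μ) :
    Integrable (fun x => |f x| ^ p.toReal) μ :=
  (Lp.memLp f).integrable_norm_rpow hp0 hp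

variable {p : ℝ≥0∞} [Fact (1 ≤ p)]

/-- The subspace of the functions that vanish almost everywhere off `A`. It is defined as the kernel
of the restriction to `Aᶜ`, which makes it closed. -/
noncomputable def LpSupp (p : ℝ≥0∞) [Fact (1 ≤ p)] (A : Set ℝ) : Submodule ℝ (Lp ℝ p (volume : Measure ℝ)) :=
  LinearMap.ker (LpToLpRestrictCLM ℝ ℝ ℝ (volume : Measure ℝ) p Aᶜ).toLinearMap

lemma mem_LpSupp_iff {A : Set ℝ} (hA : MeasurableSet A) {f : Lp ℝ p (volume : Measure ℝ)} :
    f ∈ LpSupp p A ↔ ∀ᵐ x, x ∉ A → f x = 0 := by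
  have h1 : f ∈ LpSupp p A ↔ LpToLpRestrictCLM ℝ ℝ ℝ (volume : Measure ℝ) p Aᶜ f = 0 := by
    simp [LpSupp, LinearMap.mem_ker]
  have h2 := LpToLpRestrictCLM_coeFn ℝ Aᶜ f
  rw [h1, Lp.eq_zero_iff_ae_eq_zero]
  have h3 : (∀ᵐ x, x ∉ A → f x = 0) ↔ ∀ᵐ x ∂((volume : Measure ℝ).restrict Aᶜ), f x = 0 := by
    rw [ae_restrict_iff' hA.compl]
    rfl
  rw [h3]
  constructor
  · intro h
    filter_upwards [h, h2] with x hx hx2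
    rw [← hx2, hx]
    rfl
  · intro h
    filter_upwards [h, h2] with x hx hx2
    rw [hx2, hx]
    rfl

lemma isClosed_LpSupp (A : Set ℝ) : IsClosed (LpSupp p A : Set (Lp ℝ p (volume : Measure ℝ))) :=
  ContinuousLinearMap.isClosed_ker (LpToLpRestrictCLM ℝ ℝ ℝ (volume : Measure ℝ) p Aᶜ)

lemma LpSupp_mono {A B : Set ℝ} (hA : MeasurableSet A) (hB : MeasurableSet B) (h : A ⊆ B) :
    LpSupp p A ≤ LpSupp p B := by
  intro f hf
  rw [mem_LpSupp_iff hB]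
  filter_upwards [(mem_LpSupp_iff hA).1 hf] with x hx hxB
  exact hx fun hxA => hxB (h hxA)

lemma tsum_mem_LpSupp {ι : Type*} {A : Set ℝ} {f : ι → Lp ℝ p (volume : Measure ℝ)}
    (h : ∀ i, f i ∈ LpSupp p A) : ∑' i, f i ∈ LpSupp p A := by
  by_cases hs : Summable f
  · exact (isClosed_LpSupp A).mem_of_tendsto hs.hasSum
      (Eventually.of_forall fun s => Submodule.sum_mem _ fun i _ => h i)
  · rw [tsum_eq_zero_of_not_summable hs]
    exact Submodule.zero_mem _

lemma norm_add_rpow_of_disjoint (hp : p ≠ ∞) {A B : Set ℝ} (hA : MeasurableSet A)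
    (hB : MeasurableSet B) (hAB : Disjoint A B) {f g : Lp ℝ p (volume : Measure ℝ)}
    (hf : f ∈ LpSupp p A) (hg : g ∈ LpSupp p B) :
    ‖f + g‖ ^ p.toReal = ‖f‖ ^ p.toReal + ‖g‖ ^ p.toReal := by
  have hp0 : p ≠ 0 := (zero_lt_one.trans_le (Fact.out : 1 ≤ p)).ne'
  have hq : 0 < p.toReal := ENNReal.toReal_pos hp0 hp
  rw [Lp_norm_rpow_eq_integral hp0 hp, Lp_norm_rpow_eq_integral hp0 hp,
    Lp_norm_rpow_eq_integral hp0 hp,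
    ← integral_add (Lp_integrable_rpow hp0 hp f) (Lp_integrable_rpow hp0 hp g)]
  refine integral_congr_ae ?_
  filter_upwards [(mem_LpSupp_iff hA).1 hf, (mem_LpSupp_iff hB).1 hg, Lp.coeFn_add f g]
    with x hfx hgx hx
  rw [hx, Pi.add_apply]
  by_cases hxA : x ∈ A
  · rw [hgx (Set.disjoint_left.1 hAB hxA)]
    simp [Real.zero_rpow hq.ne']
  · rw [hfx hxA]
    simp [Real.zero_rpow hq.ne']

lemma norm_sum_rpow_of_disjoint {ι : Type*} (hp : p ≠ ∞) {A : ι → Set ℝ}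
    (hA : ∀ i, MeasurableSet (A i)) (hAd : Pairwise (Function.onFun Disjoint A))
    {f : ι → Lp ℝ p (volume : Measure ℝ)} (hf : ∀ i, f i ∈ LpSupp p (A i)) (s : Finset ι) :
    ‖∑ i ∈ s, f i‖ ^ p.toReal = ∑ i ∈ s, ‖f i‖ ^ p.toReal := by
  classical
  have hp0 : p ≠ 0 := (zero_lt_one.trans_le (Fact.out : 1 ≤ p)).ne'
  have hq : 0 < p.toReal := ENNReal.toReal_pos hp0 hp
  induction s using Finset.induction_on with
  | empty => simp [Real.zero_rpow hq.ne']
  | insert i s hi ih =>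
    rw [Finset.sum_insert hi, Finset.sum_insert hi, ← ih]
    have hm : MeasurableSet (⋃ j ∈ s, A j) := Finset.measurableSet_biUnion s fun j _ => hA j
    refine norm_add_rpow_of_disjoint hp (hA i) hm ?_ (hf i) (Submodule.sum_mem _ fun j hj => ?_)
    · rw [Set.disjoint_iUnion₂_right]
      intro j hj
      exact hAd (fun h => hi (h ▸ hj))
    · exact LpSupp_mono (hA j) hm (Set.subset_biUnion_of_mem (u := A) hj) (hf j)

lemma summable_of_disjoint {ι : Type*} (hp : p ≠ ∞) {A : ι → Set ℝ}
    (hA : ∀ i, MeasurableSet (A i)) (hAd : Pairwise (Function.onFun Disjoint A))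
    {f : ι → Lp ℝ p (volume : Measure ℝ)} (hf : ∀ i, f i ∈ LpSupp p (A i))
    (hs : Summable fun i => ‖f i‖ ^ p.toReal) : Summable f := by
  have hp0 : p ≠ 0 := (zero_lt_one.trans_le (Fact.out : 1 ≤ p)).ne'
  have hq : 0 < p.toReal := ENNReal.toReal_pos hp0 hp
  rw [summable_iff_vanishing_norm]
  intro ε hε
  obtain ⟨s, hs⟩ := summable_iff_vanishing_norm.1 hs (ε ^ p.toReal) (by positivity)
  refine ⟨s, fun t ht => ?_⟩
  have h := hs t ht
  rw [← norm_sum_rpow_of_disjoint hp hA hAd hf, Real.norm_eq_abs,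
    abs_of_nonneg (by positivity)] at h
  exact (Real.rpow_lt_rpow_iff (norm_nonneg _) hε.le hq).1 h

lemma lpTranslate_coeFn (l : ℝ) (f : Lp ℝ p (volume : Measure ℝ)) :
    lpTranslate p l f =ᵐ[volume] fun x => f (x - l) :=
  Lp.coeFn_compMeasurePreserving f (measurePreserving_sub_right volume l)

lemma lpTranslate_lpTranslate (a b : ℝ) (f : Lp ℝ p (volume : Measure ℝ)) :
    lpTranslate p a (lpTranslate p b f) = lpTranslate p (a + b) f := by
  apply Lp.ext
  have h := (measurePreserving_sub_right (volume : Measure ℝ) a).quasiMeasurePreserving.ae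
    (lpTranslate_coeFn b f)
  filter_upwards [lpTranslate_coeFn a (lpTranslate p b f), lpTranslate_coeFn (a + b) f, h]
    with x h1 h2 h3
  rw [h1, h2, h3]
  congr 1
  ring

lemma lpTranslate_zero (f : Lp ℝ p (volume : Measure ℝ)) : lpTranslate p 0 f = f := by
  apply Lp.ext
  filter_upwards [lpTranslate_coeFn 0 f] with x h1
  rw [h1, sub_zero]

lemma lpTranslate_mem_LpSupp {A : Set ℝ} (hA : MeasurableSet A) (l : ℝ)
    {f : Lp ℝ p (volume : Measure ℝ)} (hf : f ∈ LpSupp p A) :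
    lpTranslate p l f ∈ LpSupp p ((fun x => x - l) ⁻¹' A) := by
  have hm : MeasurableSet ((fun x => x - l) ⁻¹' A) := (measurable_sub_const l) hA
  rw [mem_LpSupp_iff hm]
  have h := (measurePreserving_sub_right (volume : Measure ℝ) l).quasiMeasurePreserving.ae
    ((mem_LpSupp_iff hA).1 hf)
  filter_upwards [lpTranslate_coeFn l f, h] with x h1 h2 hx
  rw [h1]
  exact h2 hx

end LpSupp

/-! ### Burkholder's function -/

section Burkholder

/-- Burkholder's function: it is concave along the lines of slope `1` and `-1`, and it majorizes a
multiple of `|y| ^ q - C * |x| ^ q`. -/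
noncomputable def burkholderFun (q x y : ℝ) : ℝ :=
  (|x| + |y|) ^ (q - 1) * (|y| - (q - 1) * |x|)

lemma concaveOn_comp_posPart {φ φ' : ℝ → ℝ} (hc : ContinuousOn φ (Set.Ici 0))
    (hd : ∀ t, 0 < t → HasDerivAt φ (φ' t) t) (ha : AntitoneOn φ' (Set.Ioi 0))
    (hn : ∀ t, 0 < t → φ' t ≤ 0) : ConcaveOn ℝ Set.univ (fun t => φ (max t 0)) := by
  have hint : interior (Set.Ici (0 : ℝ)) = Set.Ioi 0 := interior_Ici
  have h1 : ConcaveOn ℝ (Set.Ici 0) φ := by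
    refine AntitoneOn.concaveOn_of_deriv (convex_Ici 0) hc ?_ ?_
    · rw [hint]
      exact fun t ht => (hd t ht).differentiableAt.differentiableWithinAt
    · rw [hint]
      exact ha.congr fun t ht => (hd t ht).deriv.symm
  have h2 : AntitoneOn φ (Set.Ici 0) := by
    refine antitoneOn_of_deriv_nonpos (convex_Ici 0) hc ?_ ?_
    · rw [hint]
      exact fun t ht => (hd t ht).differentiableAt.differentiableWithinAt
    · rw [hint]
      intro t ht
      rw [(hd t ht).deriv]
      exact hn t ht
  have himg : (fun t : ℝ => max t 0) '' Set.univ ⊆ Set.Ici 0 := by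
    rintro _ ⟨t, -, rfl⟩
    exact Set.mem_Ici.2 (le_max_right t 0)
  have himg2 : (fun t : ℝ => max t 0) '' Set.univ = Set.Ici 0 := by
    refine himg.antisymm fun t ht => ⟨t, trivial, max_eq_left (Set.mem_Ici.1 ht)⟩
  have hconv : ConvexOn ℝ Set.univ (fun t : ℝ => max t 0) :=
    (convexOn_id (convex_univ : Convex ℝ (Set.univ : Set ℝ))).sup (convexOn_const 0 convex_univ)
  exact ConcaveOn.comp_convexOn (g := φ) (by rw [himg2]; exact h1) hconv (by rw [himg2]; exact h2)

variable {q : ℝ}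

lemma burkholderFun_neg_right (x y : ℝ) : burkholderFun q x (-y) = burkholderFun q x y := by
  simp [burkholderFun]

lemma burkholderFun_neg_neg (x y : ℝ) : burkholderFun q (-x) (-y) = burkholderFun q x y := by
  simp [burkholderFun]

lemma burkholderFun_zero : burkholderFun q 0 0 = 0 := by
  simp [burkholderFun]

lemma concaveOn_burkholderFun_line_of_nonneg (hq : 2 < q) {c : ℝ} (hc : 0 ≤ c) :
    ConcaveOn ℝ Set.univ (fun t => burkholderFun q t (t + c)) := by
  have hcq : c ^ (q - 1) = c ^ (q - 2) * c := by
    rw [← Real.rpow_add_one' hc (by linarith)]; congr 1; ring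
  -- the corrections, on the half-lines `t ≥ 0` and `t ≤ -c`, to the linear function that agrees
  -- with `burkholderFun q t (t + c)` for `-c ≤ t ≤ 0`
  let φ₁ : ℝ → ℝ := fun t => (2 * t + c) ^ (q - 1) * (c - (q - 2) * t) - c ^ (q - 1) * (c + q * t)
  let φ₂ : ℝ → ℝ := fun t =>
    -((2 * t + c) ^ (q - 1) * ((q - 1) * c + (q - 2) * t)) + c ^ (q - 1) * ((q - 1) * c + q * t)
  have hpow : ∀ t : ℝ, 0 < t → HasDerivAt (fun t => (2 * t + c) ^ (q - 1))
      (2 * (q - 1) * (2 * t + c) ^ (q - 2)) t := by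
    intro t ht
    have h1 : HasDerivAt (fun t : ℝ => 2 * t + c) 2 t := by
      simpa using ((hasDerivAt_id t).const_mul 2).add_const c
    have h2 := h1.rpow_const (p := q - 1) (Or.inl (by positivity))
    convert h2 using 1
    rw [show q - 1 - 1 = q - 2 by ring]
  have hs : ∀ t : ℝ, 0 < t → (2 * t + c) ^ (q - 1) = (2 * t + c) ^ (q - 2) * (2 * t + c) := by
    intro t ht
    rw [← Real.rpow_add_one' (by positivity) (by linarith)]; congr 1; ring
  have hcont : Continuous fun t : ℝ => (2 * t + c) ^ (q - 1) :=
    (by fun_prop : Continuous fun t : ℝ => 2 * t + c).rpow_const fun _ => Or.inr (by linarith)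
  have hψ : AntitoneOn (fun s : ℝ => s ^ (q - 2) * ((q - 1) * c - (q - 2) * s)) (Set.Ici c) := by
    refine antitoneOn_of_deriv_nonpos (convex_Ici c) ?_ ?_ ?_
    · exact ((continuous_id.rpow_const fun _ => Or.inr (by linarith)).mul
        (by fun_prop)).continuousOn
    all_goals rw [interior_Ici]; intro s hs
    all_goals
      have hs0 : 0 < s := hc.trans_lt hs
      have hd : HasDerivAt (fun s : ℝ => s ^ (q - 2) * ((q - 1) * c - (q - 2) * s))
          ((q - 2) * s ^ (q - 2 - 1) * ((q - 1) * c - (q - 2) * s) +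
            s ^ (q - 2) * -((q - 2) * 1)) s :=
        (Real.hasDerivAt_rpow_const (Or.inl hs0.ne')).mul
          (((hasDerivAt_id s).const_mul (q - 2)).const_sub _)
    · exact hd.differentiableAt.differentiableWithinAt
    · rw [hd.deriv]
      have h1 : s ^ (q - 2) = s ^ (q - 2 - 1) * s := by
        rw [← Real.rpow_add_one hs0.ne']; congr 1; ring
      rw [h1]
      have h2 : 0 ≤ s ^ (q - 2 - 1) := by positivity
      have h3 : (q - 2) * s ^ (q - 2 - 1) * ((q - 1) * c - (q - 2) * s) +
            s ^ (q - 2 - 1) * s * -((q - 2) * 1)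
          = -((q - 2) * (q - 1) * (s - c) * s ^ (q - 2 - 1)) := by ring
      rw [h3, neg_nonpos]
      have h4 : c < s := hs
      exact mul_nonneg (mul_nonneg (mul_nonneg (by linarith) (by linarith)) (by linarith)) h2
  have h₁ : ConcaveOn ℝ Set.univ (fun t => φ₁ (max t 0)) := by
    refine concaveOn_comp_posPart (φ' := fun t => q * ((2 * t + c) ^ (q - 2) *
      ((q - 1) * c - (q - 2) * (2 * t + c)) - c ^ (q - 1))) ?_ ?_ ?_ ?_
    · exact ((hcont.mul (by fun_prop)).sub (by fun_prop)).continuousOn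
    · intro t ht
      have h := ((hpow t ht).mul (((hasDerivAt_id t).const_mul (q - 2)).const_sub c)).sub
        (((((hasDerivAt_id t).const_mul q).const_add c)).const_mul (c ^ (q - 1)))
      refine h.congr_deriv ?_
      simp only [id, mul_one, hs t ht]
      ring
    · intro t ht t' ht' htt
      have ht0 : (0 : ℝ) < t := ht
      have := hψ (a := 2 * t + c) (b := 2 * t' + c) (Set.mem_Ici.2 (by linarith))
        (Set.mem_Ici.2 (by linarith)) (by linarith)
      simp only at this ⊢
      exact mul_le_mul_of_nonneg_left (by linarith) (by linarith)
    · intro t ht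
      have := hψ (a := c) (b := 2 * t + c) (Set.mem_Ici.2 le_rfl)
        (Set.mem_Ici.2 (by linarith)) (by linarith)
      simp only at this
      refine mul_nonpos_of_nonneg_of_nonpos (by linarith) ?_
      rw [hcq]
      linarith
  have h₂ : ConcaveOn ℝ Set.univ (fun t => φ₂ (max t 0)) := by
    refine concaveOn_comp_posPart (φ' := fun t => -(q * (q - 1) * c * (2 * t + c) ^ (q - 2) +
      q * (q - 2) * (2 * t + c) ^ (q - 1)) + q * c ^ (q - 1)) ?_ ?_ ?_ ?_
    · exact ((hcont.mul (by fun_prop)).neg.add (by fun_prop)).continuousOn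
    · intro t ht
      have h := ((hpow t ht).mul (((hasDerivAt_id t).const_mul (q - 2)).const_add
        ((q - 1) * c))).neg.add
        (((((hasDerivAt_id t).const_mul q).const_add ((q - 1) * c))).const_mul (c ^ (q - 1)))
      refine h.congr_deriv ?_
      simp only [id, mul_one, hs t ht]
      ring
    · intro t ht t' ht' htt
      have ht0 : (0 : ℝ) < t := ht
      have e1 : (2 * t + c) ^ (q - 2) ≤ (2 * t' + c) ^ (q - 2) :=
        Real.rpow_le_rpow (by linarith) (by linarith) (by linarith)
      have e2 : (2 * t + c) ^ (q - 1) ≤ (2 * t' + c) ^ (q - 1) :=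
        Real.rpow_le_rpow (by linarith) (by linarith) (by linarith)
      have e3 : q * (q - 1) * c * (2 * t + c) ^ (q - 2)
          ≤ q * (q - 1) * c * (2 * t' + c) ^ (q - 2) :=
        mul_le_mul_of_nonneg_left e1
          (mul_nonneg (mul_nonneg (by linarith) (by linarith)) hc)
      have e4 : q * (q - 2) * (2 * t + c) ^ (q - 1) ≤ q * (q - 2) * (2 * t' + c) ^ (q - 1) :=
        mul_le_mul_of_nonneg_left e2 (mul_nonneg (by linarith) (by linarith))
      simp only
      linarith
    · intro t ht
      have e1 : c ^ (q - 2) ≤ (2 * t + c) ^ (q - 2) :=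
        Real.rpow_le_rpow hc (by linarith) (by linarith)
      have e3 : q * (q - 1) * c * c ^ (q - 2) ≤ q * (q - 1) * c * (2 * t + c) ^ (q - 2) :=
        mul_le_mul_of_nonneg_left e1
          (mul_nonneg (mul_nonneg (by linarith) (by linarith)) hc)
      have e4 : 0 ≤ q * (q - 2) * (2 * t + c) ^ (q - 1) :=
        mul_nonneg (mul_nonneg (by linarith) (by linarith)) (by positivity)
      have e5 : 0 ≤ q * (q - 2) * c ^ (q - 1) :=
        mul_nonneg (mul_nonneg (by linarith) (by linarith)) (by positivity)
      have e6 : q * (q - 1) * c * c ^ (q - 2) = q * (q - 1) * c ^ (q - 1) := by rw [hcq]; ring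
      linarith
  have h₂' : ConcaveOn ℝ Set.univ (fun t => φ₂ (max (-t - c) 0)) := by
    have := h₂.comp_affineMap ((-AffineMap.id ℝ ℝ) - AffineMap.const ℝ ℝ c)
    simpa [Function.comp_def] using this
  have hlin : ConcaveOn ℝ Set.univ (fun t : ℝ => c ^ (q - 1) * (c + q * t)) := by
    refine ⟨convex_univ, fun x _ y _ a b _ _ hab => le_of_eq ?_⟩
    simp only [smul_eq_mul]
    linear_combination (c ^ (q - 1) * c) * hab
  refine ((hlin.add h₁).add h₂').congr fun t _ => ?_
  simp only [Pi.add_apply, burkholderFun, φ₁, φ₂]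
  rcases le_total 0 t with ht | ht
  · rw [max_eq_left ht, max_eq_right (by linarith), abs_of_nonneg ht, abs_of_nonneg (by linarith),
      show t + (t + c) = 2 * t + c by ring]
    simp only [mul_zero, zero_add, add_zero]
    ring
  · rcases le_total (-c) t with ht' | ht'
    · rw [max_eq_right ht, max_eq_right (by linarith), abs_of_nonpos ht,
        abs_of_nonneg (by linarith), show -t + (t + c) = c by ring]
      simp only [mul_zero, zero_add, add_zero]
      ring
    · rw [max_eq_right ht, max_eq_left (by linarith), abs_of_nonpos ht,
        abs_of_nonpos (by linarith), show -t + -(t + c) = 2 * (-t - c) + c by ring]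
      simp only [mul_zero, zero_add, add_zero]
      ring

lemma concaveOn_burkholderFun_line (hq : 2 < q) (c : ℝ) :
    ConcaveOn ℝ Set.univ (fun t => burkholderFun q t (t + c)) := by
  rcases le_total 0 c with hc | hc
  · exact concaveOn_burkholderFun_line_of_nonneg hq hc
  · have h := (concaveOn_burkholderFun_line_of_nonneg hq (neg_nonneg.2 hc)).comp_affineMap
      (-AffineMap.id ℝ ℝ)
    refine (show ConcaveOn ℝ Set.univ _ by simpa [Function.comp_def] using h).congr fun t _ => ?_
    rw [← burkholderFun_neg_neg]
    congr 1 <;> ring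

/-- Midpoint concavity of Burkholder's function along lines of slope `1` and `-1`. -/
lemma burkholderFun_add_sub_le (hq : 2 < q) (x y b : ℝ) {e : ℝ} (he : e = 1 ∨ e = -1) :
    burkholderFun q (x + b) (y + e * b) + burkholderFun q (x - b) (y - e * b) ≤
      2 * burkholderFun q x y := by
  have key : ∀ y : ℝ, burkholderFun q (x + b) (y + b) + burkholderFun q (x - b) (y - b) ≤
      2 * burkholderFun q x y := by
    intro y
    have h := (concaveOn_burkholderFun_line hq (y - x)).2 (Set.mem_univ (x + b))
      (Set.mem_univ (x - b)) (show (0 : ℝ) ≤ 1 / 2 by norm_num)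
      (show (0 : ℝ) ≤ 1 / 2 by norm_num) (by norm_num)
    simp only [smul_eq_mul] at h
    rw [show x + b + (y - x) = y + b by ring, show x - b + (y - x) = y - b by ring,
      show 1 / 2 * (x + b) + 1 / 2 * (x - b) = x by ring, show x + (y - x) = y by ring] at h
    linarith
  rcases he with rfl | rfl
  · simpa using key y
  · have := key (-y)
    rw [burkholderFun_neg_right, ← burkholderFun_neg_right (x + b),
      ← burkholderFun_neg_right (x - b)] at this
    refine le_trans (le_of_eq ?_) this
    congr 2 <;> ring

lemma exists_rpow_le_add_burkholderFun (hq : 2 < q) :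
    ∃ C : ℝ, 1 ≤ C ∧ ∀ x y : ℝ, |y| ^ q ≤ C * |x| ^ q + 2 * burkholderFun q x y := by
  have hrq : ∀ z : ℝ, |z| ^ (q - 1) * |z| = |z| ^ q := by
    intro z
    rw [← Real.rpow_add_one' (abs_nonneg _) (by linarith)]; congr 1; ring
  have hq1 : 0 < q - 1 := by linarith
  refine ⟨1 + (2 * (q - 1)) ^ q + 2 * (2 * q - 1) ^ (q - 1) * (q - 1), ?_, fun x y => ?_⟩
  · have h1 : 0 ≤ (2 * (q - 1)) ^ q := by positivity
    have h2 : 0 ≤ (2 * q - 1) ^ (q - 1) := Real.rpow_nonneg (by linarith) _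
    have : 0 ≤ 2 * (2 * q - 1) ^ (q - 1) * (q - 1) := by positivity
    linarith
  · have hx : 0 ≤ |x| := abs_nonneg x
    have hy : 0 ≤ |y| := abs_nonneg y
    have hxq : 0 ≤ |x| ^ q := by positivity
    have h2 : 0 ≤ (2 * q - 1) ^ (q - 1) := Real.rpow_nonneg (by linarith) _
    simp only [burkholderFun]
    rcases le_total (2 * (q - 1) * |x|) |y| with h | h
    · have e1 : |y| ^ (q - 1) ≤ (|x| + |y|) ^ (q - 1) :=
        Real.rpow_le_rpow hy (by linarith) hq1.le
      have e2 : |y| ^ (q - 1) * (|y| / 2) ≤ (|x| + |y|) ^ (q - 1) * (|y| - (q - 1) * |x|) :=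
        mul_le_mul e1 (by linarith) (by positivity) (by positivity)
      have e3 := hrq y
      have e4 : 0 ≤ (1 + (2 * (q - 1)) ^ q + 2 * (2 * q - 1) ^ (q - 1) * (q - 1)) * |x| ^ q := by
        positivity
      linarith
    · have e1 : |y| ^ q ≤ (2 * (q - 1)) ^ q * |x| ^ q := by
        rw [← Real.mul_rpow (by linarith) hx]
        exact Real.rpow_le_rpow hy h (by linarith)
      have e2 : (|x| + |y|) ^ (q - 1) ≤ (2 * q - 1) ^ (q - 1) * |x| ^ (q - 1) := by
        rw [← Real.mul_rpow (by linarith) hx]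
        exact Real.rpow_le_rpow (by positivity) (by linarith) hq1.le
      have e3 : (|x| + |y|) ^ (q - 1) * ((q - 1) * |x|)
          ≤ (2 * q - 1) ^ (q - 1) * |x| ^ (q - 1) * ((q - 1) * |x|) :=
        mul_le_mul_of_nonneg_right e2 (by positivity)
      have e4 : (2 * q - 1) ^ (q - 1) * |x| ^ (q - 1) * ((q - 1) * |x|)
          = (2 * q - 1) ^ (q - 1) * (q - 1) * |x| ^ q := by rw [← hrq x]; ring
      have e5 : 0 ≤ (|x| + |y|) ^ (q - 1) * |y| := by positivity
      linarith

end Burkholder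

/-! ### The Haar system of the line -/

section Haar

/-- The dyadic interval `[m * 2 ^ k, (m + 1) * 2 ^ k)`, where `I = (k, m)`. -/
def dyadicIco (I : ℤ × ℤ) : Set ℝ := Set.Ico (I.2 * 2 ^ I.1) ((I.2 + 1) * 2 ^ I.1)

lemma mem_dyadicIco_iff {I : ℤ × ℤ} {x : ℝ} : x ∈ dyadicIco I ↔ ⌊x / 2 ^ I.1⌋ = I.2 := by
  have h : (0 : ℝ) < 2 ^ I.1 := by positivity
  rw [Int.floor_eq_iff, dyadicIco, Set.mem_Ico, le_div_iff₀ h, div_lt_iff₀ h]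

lemma measurableSet_dyadicIco (I : ℤ × ℤ) : MeasurableSet (dyadicIco I) := measurableSet_Ico

lemma volume_dyadicIco (I : ℤ × ℤ) : volume (dyadicIco I) = ENNReal.ofReal (2 ^ I.1) := by
  rw [dyadicIco, Real.volume_Ico]
  congr 1
  ring

lemma volume_dyadicIco_ne_top (I : ℤ × ℤ) : volume (dyadicIco I) ≠ ∞ := by
  rw [volume_dyadicIco]
  exact ENNReal.ofReal_ne_top

lemma volume_real_dyadicIco (I : ℤ × ℤ) : volume.real (dyadicIco I) = 2 ^ I.1 := by
  rw [Measure.real, volume_dyadicIco, ENNReal.toReal_ofReal (by positivity)]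

/-- The left half of a dyadic interval. -/
def leftHalf (I : ℤ × ℤ) : ℤ × ℤ := (I.1 - 1, 2 * I.2)

/-- The right half of a dyadic interval. -/
def rightHalf (I : ℤ × ℤ) : ℤ × ℤ := (I.1 - 1, 2 * I.2 + 1)

/-- The Haar function of a dyadic interval, `1` on the left half and `-1` on the right half. -/
noncomputable def haarFun (I : ℤ × ℤ) (x : ℝ) : ℝ :=
  (dyadicIco (leftHalf I)).indicator (fun _ => 1) x -
    (dyadicIco (rightHalf I)).indicator (fun _ => 1) x

lemma floor_div_two_zpow_add (x : ℝ) (k : ℤ) (n : ℕ) :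
    ⌊x / 2 ^ (k + n)⌋ = ⌊x / 2 ^ k⌋ / 2 ^ n := by
  have h : x / 2 ^ (k + (n : ℤ)) = x / 2 ^ k / ((2 ^ n : ℕ) : ℝ) := by
    rw [zpow_add₀ (by norm_num), zpow_natCast, div_div]
    push_cast
    rfl
  rw [h, Int.floor_div_natCast]
  push_cast
  rfl

/-- A Haar function is constant on the other dyadic intervals of at most the same length. -/
lemma exists_haarFun_eq_const {I J : ℤ × ℤ} (hIJ : J ≠ I) (hle : I.1 ≤ J.1) :
    ∃ e : ℝ, ∀ x ∈ dyadicIco I, haarFun J x = e := by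
  classical
  obtain ⟨k, m⟩ := I
  obtain ⟨k', m'⟩ := J
  simp only at hle
  rcases hle.eq_or_lt with rfl | hlt
  · refine ⟨0, fun x hx => ?_⟩
    have hm : m' ≠ m := fun h => hIJ (by rw [h])
    rw [mem_dyadicIco_iff] at hx
    simp only at hx
    have h1 := floor_div_two_zpow_add x (k - 1) 1
    rw [show k - 1 + ((1 : ℕ) : ℤ) = k by push_cast; ring, hx] at h1
    have hl : x ∉ dyadicIco (leftHalf (k, m')) := by
      rw [mem_dyadicIco_iff]
      simp only [leftHalf]
      omega
    have hr : x ∉ dyadicIco (rightHalf (k, m')) := by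
      rw [mem_dyadicIco_iff]
      simp only [rightHalf]
      omega
    rw [haarFun, Set.indicator_of_notMem hl, Set.indicator_of_notMem hr, sub_zero]
  · obtain ⟨n, hn⟩ := Int.le.dest (show k ≤ k' - 1 by omega)
    refine ⟨(if m / 2 ^ n = 2 * m' then 1 else 0) - if m / 2 ^ n = 2 * m' + 1 then 1 else 0,
      fun x hx => ?_⟩
    rw [mem_dyadicIco_iff] at hx
    simp only at hx
    have h1 := floor_div_two_zpow_add x k n
    rw [hn, hx] at h1
    simp only [haarFun, Set.indicator_apply, mem_dyadicIco_iff, leftHalf, rightHalf, h1]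

lemma disjoint_leftHalf_rightHalf (I : ℤ × ℤ) :
    Disjoint (dyadicIco (leftHalf I)) (dyadicIco (rightHalf I)) := by
  rw [Set.disjoint_left]
  intro x hx hx'
  rw [mem_dyadicIco_iff] at hx hx'
  simp only [leftHalf, rightHalf] at hx hx'
  omega

lemma dyadicIco_leftHalf_union_rightHalf (I : ℤ × ℤ) :
    dyadicIco (leftHalf I) ∪ dyadicIco (rightHalf I) = dyadicIco I := by
  ext x
  have h1 := floor_div_two_zpow_add x (I.1 - 1) 1
  rw [show I.1 - 1 + ((1 : ℕ) : ℤ) = I.1 by push_cast; ring] at h1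
  simp only [Set.mem_union, mem_dyadicIco_iff, leftHalf, rightHalf]
  omega

/-- Changing signs in a Haar expansion turns the pair of partial sums into a zigzag martingale, along
which the integral of Burkholder's function does not increase. The intervals are added in order of
decreasing length. -/
lemma integral_burkholderFun_haar_le_zero {q : ℝ} (hq : 2 < q) (b e : ℤ × ℤ → ℝ)
    (he : ∀ I, e I = 1 ∨ e I = -1) (s : Finset (ℤ × ℤ)) :
    Integrable (fun x => burkholderFun q (∑ I ∈ s, b I * haarFun I x)
      (∑ I ∈ s, e I * (b I * haarFun I x))) ∧
    ∫ x, burkholderFun q (∑ I ∈ s, b I * haarFun I x)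
      (∑ I ∈ s, e I * (b I * haarFun I x)) ≤ 0 := by
  classical
  refine Finset.induction_on_min_value (f := fun I : ℤ × ℤ => I.1) s ?_ ?_
  · simp [burkholderFun_zero]
  · intro I s hIs hmin ih
    obtain ⟨hint, hle⟩ := ih
    set F : ℝ → ℝ := fun x => burkholderFun q (∑ J ∈ s, b J * haarFun J x)
      (∑ J ∈ s, e J * (b J * haarFun J x)) with hF
    -- on `I` the functions of the longer intervals are constants
    have hconst : ∀ J : ℤ × ℤ, ∃ v : ℝ, J ∈ s → ∀ x ∈ dyadicIco I, haarFun J x = v := by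
      intro J
      by_cases hJ : J ∈ s
      · obtain ⟨v, hv⟩ := exists_haarFun_eq_const (I := I) (J := J)
          (fun h => hIs (h ▸ hJ)) (hmin J hJ)
        exact ⟨v, fun _ => hv⟩
      · exact ⟨0, fun h => absurd h hJ⟩
    choose v hv using hconst
    set X := ∑ J ∈ s, b J * v J with hX
    set Y := ∑ J ∈ s, e J * (b J * v J) with hY
    have hXx : ∀ x ∈ dyadicIco I, ∑ J ∈ s, b J * haarFun J x = X := fun x hx =>
      Finset.sum_congr rfl fun J hJ => by rw [hv J hJ x hx]
    have hYx : ∀ x ∈ dyadicIco I, ∑ J ∈ s, e J * (b J * haarFun J x) = Y := fun x hx =>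
      Finset.sum_congr rfl fun J hJ => by rw [hv J hJ x hx]
    set α := burkholderFun q (X + b I) (Y + e I * b I) - burkholderFun q X Y with hα
    set β := burkholderFun q (X - b I) (Y - e I * b I) - burkholderFun q X Y with hβ
    have hαβ : α + β ≤ 0 := by
      have := burkholderFun_add_sub_le hq X Y (b I) (he I)
      rw [hα, hβ]
      linarith
    have hstep : (fun x => burkholderFun q (∑ J ∈ insert I s, b J * haarFun J x)
        (∑ J ∈ insert I s, e J * (b J * haarFun J x))) =
        fun x => F x + ((dyadicIco (leftHalf I)).indicator (fun _ => α) x +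
          (dyadicIco (rightHalf I)).indicator (fun _ => β) x) := by
      funext x
      simp only [Finset.sum_insert hIs, hF]
      by_cases hl : x ∈ dyadicIco (leftHalf I)
      · have hr := Set.disjoint_left.1 (disjoint_leftHalf_rightHalf I) hl
        have hxI : x ∈ dyadicIco I := by
          rw [← dyadicIco_leftHalf_union_rightHalf]
          exact Or.inl hl
        rw [haarFun, Set.indicator_of_mem hl, Set.indicator_of_notMem hr,
          Set.indicator_of_mem hl, Set.indicator_of_notMem hr, hXx x hxI, hYx x hxI, hα,
          show b I * (1 - 0) + X = X + b I by ring,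
          show e I * (b I * (1 - 0)) + Y = Y + e I * b I by ring]
        ring
      · by_cases hr : x ∈ dyadicIco (rightHalf I)
        · have hxI : x ∈ dyadicIco I := by
            rw [← dyadicIco_leftHalf_union_rightHalf]
            exact Or.inr hr
          rw [haarFun, Set.indicator_of_notMem hl, Set.indicator_of_mem hr,
            Set.indicator_of_notMem hl, Set.indicator_of_mem hr, hXx x hxI, hYx x hxI, hβ,
            show b I * (0 - 1) + X = X - b I by ring,
            show e I * (b I * (0 - 1)) + Y = Y - e I * b I by ring]
          ring
        · rw [haarFun, Set.indicator_of_notMem hl, Set.indicator_of_notMem hr,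
            Set.indicator_of_notMem hl, Set.indicator_of_notMem hr]
          simp
    have hi : ∀ (J : ℤ × ℤ) (c : ℝ), Integrable ((dyadicIco J).indicator fun _ => c) := fun J c =>
      (integrable_indicator_iff (measurableSet_dyadicIco J)).2
        (integrableOn_const (volume_dyadicIco_ne_top J))
    have hc : ∀ (J : ℤ × ℤ) (c : ℝ), ∫ x, (dyadicIco J).indicator (fun _ => c) x = 2 ^ J.1 * c := by
      intro J c
      rw [integral_indicator_const _ (measurableSet_dyadicIco J), volume_real_dyadicIco, smul_eq_mul]
    rw [hstep]
    have h12 : Integrable (fun x => (dyadicIco (leftHalf I)).indicator (fun _ => α) x +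
        (dyadicIco (rightHalf I)).indicator (fun _ => β) x) := (hi _ α).add (hi _ β)
    refine ⟨hint.add h12, ?_⟩
    rw [integral_add hint h12, integral_add (hi _ α) (hi _ β), hc, hc]
    simp only [leftHalf, rightHalf]
    have h2 : (0 : ℝ) < 2 ^ (I.1 - 1) := by positivity
    have h3 : (2 : ℝ) ^ (I.1 - 1) * (α + β) ≤ 0 := mul_nonpos_of_nonneg_of_nonpos h2.le hαβ
    linarith

variable (p : ℝ≥0∞)

/-- The indicator function of a dyadic interval, as an element of `L_p`. -/
noncomputable def dyadicLp (I : ℤ × ℤ) : Lp ℝ p (volume : Measure ℝ) :=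
  indicatorConstLp p (measurableSet_dyadicIco I) (volume_dyadicIco_ne_top I) 1

/-- The Haar function of a dyadic interval, as an element of `L_p`. -/
noncomputable def haarLp (I : ℤ × ℤ) : Lp ℝ p (volume : Measure ℝ) :=
  dyadicLp p (leftHalf I) - dyadicLp p (rightHalf I)

variable {p}

lemma haarLp_coeFn (I : ℤ × ℤ) : haarLp p I =ᵐ[volume] haarFun I := by
  have h1 : dyadicLp p (leftHalf I) =ᵐ[volume] _ := indicatorConstLp_coeFn
  have h2 : dyadicLp p (rightHalf I) =ᵐ[volume] _ := indicatorConstLp_coeFn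
  filter_upwards [Lp.coeFn_sub (dyadicLp p (leftHalf I)) (dyadicLp p (rightHalf I)), h1, h2]
    with x hx h1 h2
  rw [haarLp, hx, Pi.sub_apply, h1, h2]
  rfl

lemma sum_smul_haarLp_coeFn (b : ℤ × ℤ → ℝ) (s : Finset (ℤ × ℤ)) :
    (∑ I ∈ s, b I • haarLp p I : Lp ℝ p (volume : Measure ℝ)) =ᵐ[volume]
      fun x => ∑ I ∈ s, b I * haarFun I x := by
  classical
  induction s using Finset.induction_on with
  | empty =>
    simp only [Finset.sum_empty]
    exact Lp.coeFn_zero _ _ _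
  | insert I s hI ih =>
    simp only [Finset.sum_insert hI]
    filter_upwards [Lp.coeFn_add (b I • haarLp p I) (∑ J ∈ s, b J • haarLp p J),
      Lp.coeFn_smul (b I) (haarLp p I), haarLp_coeFn (p := p) I, ih] with x h1 h2 h3 h4
    rw [h1, Pi.add_apply, h2, Pi.smul_apply, h3, h4, smul_eq_mul]

lemma haarLp_ne_zero (I : ℤ × ℤ) : haarLp p I ≠ 0 := by
  intro h
  have h1 := haarLp_coeFn (p := p) I
  rw [h] at h1
  have h2 : ∀ᵐ x : ℝ, x ∉ dyadicIco (leftHalf I) := by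
    filter_upwards [h1, Lp.coeFn_zero ℝ p (volume : Measure ℝ)] with x hx hx0 hxl
    have hr := Set.disjoint_left.1 (disjoint_leftHalf_rightHalf I) hxl
    rw [hx0, haarFun, Set.indicator_of_mem hxl, Set.indicator_of_notMem hr] at hx
    simp at hx
  have h3 : volume (dyadicIco (leftHalf I)) = 0 := by
    rw [ae_iff] at h2
    simpa using h2
  rw [volume_dyadicIco, ENNReal.ofReal_eq_zero] at h3
  have : (0 : ℝ) < 2 ^ (leftHalf I).1 := by positivity
  linarith

/-- The Haar system is unconditional in `L_p`: sign changes are bounded. -/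
theorem exists_haarLp_signs_bound [Fact (1 ≤ p)] (hp : 2 < p) (hp_top : p ≠ ∞) :
    ∃ C : ℝ, 1 ≤ C ∧ ∀ (b e : ℤ × ℤ → ℝ), (∀ I, e I = 1 ∨ e I = -1) → ∀ s : Finset (ℤ × ℤ),
      ‖∑ I ∈ s, (e I * b I) • haarLp p I‖ ≤ C * ‖∑ I ∈ s, b I • haarLp p I‖ := by
  have hp0 : p ≠ 0 := (zero_lt_one.trans_le (Fact.out : 1 ≤ p)).ne'
  have hq : 2 < p.toReal := by
    have := (ENNReal.toReal_lt_toReal (by norm_num) hp_top).2 hp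
    simpa using this
  obtain ⟨C, hC, hCU⟩ := exists_rpow_le_add_burkholderFun hq
  refine ⟨C ^ (1 / p.toReal), Real.one_le_rpow hC (by positivity), fun b e he s => ?_⟩
  refine le_rpow_mul_of_rpow_le (by linarith) (norm_nonneg _) (norm_nonneg _) (by linarith) ?_
  obtain ⟨hint, hle⟩ := integral_burkholderFun_haar_le_zero hq b e he s
  have hf := sum_smul_haarLp_coeFn (p := p) b s
  have hg := sum_smul_haarLp_coeFn (p := p) (fun I => e I * b I) s
  have hif := Lp_integrable_rpow hp0 hp_top (∑ I ∈ s, b I • haarLp p I)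
  have hig := Lp_integrable_rpow hp0 hp_top (∑ I ∈ s, (e I * b I) • haarLp p I)
  rw [Lp_norm_rpow_eq_integral hp0 hp_top, Lp_norm_rpow_eq_integral hp0 hp_top]
  have h1 : ∫ x, |(∑ I ∈ s, (e I * b I) • haarLp p I : Lp ℝ p (volume : Measure ℝ)) x| ^ p.toReal
      ≤ ∫ x, (C * |(∑ I ∈ s, b I • haarLp p I : Lp ℝ p (volume : Measure ℝ)) x| ^ p.toReal +
        2 * burkholderFun p.toReal (∑ I ∈ s, b I * haarFun I x)
          (∑ I ∈ s, e I * (b I * haarFun I x))) := by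
    refine integral_mono_ae hig ((hif.const_mul C).add (hint.const_mul 2)) ?_
    filter_upwards [hf, hg] with x hfx hgx
    rw [hfx, hgx]
    simp only [mul_assoc]
    exact hCU _ _
  rw [integral_add (hif.const_mul C) (hint.const_mul 2), integral_const_mul,
    integral_const_mul] at h1
  linarith

end Haar

section HaarDense

variable {p : ℝ≥0∞}

lemma dyadicLp_eq_leftHalf_add_rightHalf (I : ℤ × ℤ) :
    dyadicLp p I = dyadicLp p (leftHalf I) + dyadicLp p (rightHalf I) := by
  have h := indicatorConstLp_disjoint_union (p := p) (measurableSet_dyadicIco (leftHalf I))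
    (measurableSet_dyadicIco (rightHalf I)) (volume_dyadicIco_ne_top _)
    (volume_dyadicIco_ne_top _) (disjoint_leftHalf_rightHalf I) (1 : ℝ)
  rw [dyadicLp, dyadicLp, dyadicLp, ← h]
  congr 1
  exact (dyadicIco_leftHalf_union_rightHalf I).symm

variable [Fact (1 ≤ p)]

lemma exists_parent (I : ℤ × ℤ) :
    ∃ P : ℤ × ℤ, P.1 = I.1 + 1 ∧ (I = leftHalf P ∨ I = rightHalf P) := by
  refine ⟨(I.1 + 1, I.2 / 2), rfl, ?_⟩
  rcases Int.emod_two_eq_zero_or_one I.2 with h | h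
  · left
    ext
    · simp [leftHalf]
    · simp only [leftHalf]; omega
  · right
    ext
    · simp [rightHalf]
    · simp only [rightHalf]; omega

lemma norm_dyadicLp (hp : p ≠ ∞) (I : ℤ × ℤ) :
    ‖dyadicLp p I‖ = ((2 : ℝ) ^ I.1) ^ (1 / p.toReal) := by
  have hp0 : p ≠ 0 := (zero_lt_one.trans_le (Fact.out : 1 ≤ p)).ne'
  rw [dyadicLp, norm_indicatorConstLp hp0 hp, volume_real_dyadicIco, norm_one, one_mul]

/-- Up to Haar functions, the indicator of `I` is `2⁻ⁿ` times that of its `n`-th ancestor, and for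
`p > 1` these tend to `0` in norm. -/
lemma dyadicLp_mem_closure_span_haarLp (hp1 : 1 < p) (hp : p ≠ ∞) (I : ℤ × ℤ) :
    dyadicLp p I ∈ (Submodule.span ℝ (Set.range (haarLp p))).topologicalClosure := by
  set M := (Submodule.span ℝ (Set.range (haarLp p))).topologicalClosure with hM
  have hq : 1 < p.toReal := by
    have := (ENNReal.toReal_lt_toReal (by norm_num) hp).2 hp1
    simpa using this
  have hhaar : ∀ J, haarLp p J ∈ M := fun J =>
    Submodule.le_topologicalClosure _ (Submodule.subset_span ⟨J, rfl⟩)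
  have key : ∀ (n : ℕ) (J : ℤ × ℤ), ∃ y ∈ M,
      ‖dyadicLp p J - y‖ ≤ (1 / 2) ^ n * ((2 : ℝ) ^ (J.1 + n)) ^ (1 / p.toReal) := by
    intro n
    induction n with
    | zero =>
      intro J
      refine ⟨0, Submodule.zero_mem _, ?_⟩
      rw [sub_zero, norm_dyadicLp hp]
      simp
    | succ n ih =>
      intro J
      obtain ⟨P, hP, hJ⟩ := exists_parent J
      obtain ⟨y, hy, hyn⟩ := ih P
      have hfin : ∀ z : Lp ℝ p (volume : Measure ℝ),
          dyadicLp p J - z = (1 / 2 : ℝ) • (dyadicLp p P - y) →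
          ‖dyadicLp p J - z‖ ≤
            (1 / 2) ^ (n + 1) * ((2 : ℝ) ^ (J.1 + (n + 1 : ℕ))) ^ (1 / p.toReal) := by
        intro z hz
        rw [hz, norm_smul, Real.norm_of_nonneg (by norm_num), pow_succ']
        rw [mul_assoc]
        refine mul_le_mul_of_nonneg_left (hyn.trans (le_of_eq ?_)) (by norm_num)
        rw [hP]
        congr 3
        push_cast
        ring
      rcases hJ with h | h
      · refine ⟨(1 / 2 : ℝ) • (y + haarLp p P),
          Submodule.smul_mem _ _ (Submodule.add_mem _ hy (hhaar P)), hfin _ ?_⟩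
        rw [h, dyadicLp_eq_leftHalf_add_rightHalf P, haarLp]
        module
      · refine ⟨(1 / 2 : ℝ) • (y - haarLp p P),
          Submodule.smul_mem _ _ (Submodule.sub_mem _ hy (hhaar P)), hfin _ ?_⟩
        rw [h, dyadicLp_eq_leftHalf_add_rightHalf P, haarLp]
        module
  have hcl : IsClosed (M : Set (Lp ℝ p (volume : Measure ℝ))) :=
    Submodule.isClosed_topologicalClosure _
  choose y hyM hy using fun n => key n I
  refine hcl.mem_of_tendsto (f := y) (b := atTop) ?_ (Eventually.of_forall hyM)
  rw [tendsto_iff_norm_sub_tendsto_zero]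
  have hlim : Tendsto (fun n : ℕ => ((2 : ℝ) ^ (1 / p.toReal) / 2) ^ n *
      ((2 : ℝ) ^ I.1) ^ (1 / p.toReal)) atTop (𝓝 0) := by
    rw [← zero_mul (((2 : ℝ) ^ I.1) ^ (1 / p.toReal))]
    refine (tendsto_pow_atTop_nhds_zero_of_lt_one (by positivity) ?_).mul_const _
    rw [div_lt_one (by norm_num)]
    calc (2 : ℝ) ^ (1 / p.toReal) < 2 ^ (1 : ℝ) :=
          Real.rpow_lt_rpow_of_exponent_lt (by norm_num)
            ((div_lt_one (by linarith)).2 hq)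
      _ = 2 := Real.rpow_one 2
  refine squeeze_zero (fun n => norm_nonneg _) (fun n => ?_) hlim
  rw [norm_sub_rev]
  refine (hy n).trans (le_of_eq ?_)
  rw [zpow_add₀ (by norm_num), Real.mul_rpow (by positivity) (by positivity), zpow_natCast,
    div_pow, div_pow, one_pow, ← Real.rpow_natCast ((2 : ℝ) ^ (1 / p.toReal)), ← Real.rpow_mul (by norm_num),
    mul_comm (1 / p.toReal), Real.rpow_mul (by norm_num), Real.rpow_natCast]
  ring

lemma sum_indicator_dyadicIco (g : ℝ → ℝ) (k N : ℕ) (x : ℝ) :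
    ∑ m ∈ Finset.Ico (-(N * 2 ^ k : ℤ)) (N * 2 ^ k),
      g (m / 2 ^ k) * (dyadicIco (-(k : ℤ), m)).indicator (fun _ => (1 : ℝ)) x =
    (Set.Ico (-(N : ℝ)) N).indicator (fun x => g (⌊x * 2 ^ k⌋ / 2 ^ k)) x := by
  classical
  have hmem : ∀ m : ℤ, x ∈ dyadicIco (-(k : ℤ), m) ↔ ⌊x * 2 ^ k⌋ = m := by
    intro m
    rw [mem_dyadicIco_iff]
    simp
  have h2 : (0 : ℝ) < 2 ^ k := by positivity
  simp only [Set.indicator_apply, hmem, mul_ite, mul_one, mul_zero, Finset.sum_ite_eq,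
    Finset.mem_Ico, Set.mem_Ico]
  refine if_congr ?_ rfl rfl
  rw [Int.le_floor, Int.floor_lt]
  push_cast
  rw [mul_lt_mul_iff_left₀ h2, ← neg_mul, mul_le_mul_iff_left₀ h2]

theorem closure_span_haarLp_eq_top (hp1 : 1 < p) (hp : p ≠ ∞) :
    (Submodule.span ℝ (Set.range (haarLp p))).topologicalClosure = ⊤ := by
  have hp0 : p ≠ 0 := (zero_lt_one.trans_le (Fact.out : 1 ≤ p)).ne'
  rw [eq_top_iff]
  intro f _
  set M := (Submodule.span ℝ (Set.range (haarLp p))).topologicalClosure with hM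
  have hcl : IsClosed (M : Set (Lp ℝ p (volume : Measure ℝ))) :=
    Submodule.isClosed_topologicalClosure _
  have hq : 0 < p.toReal := ENNReal.toReal_pos hp0 hp
  change f ∈ (M : Set (Lp ℝ p (volume : Measure ℝ)))
  rw [← hcl.closure_eq, Metric.mem_closure_iff]
  intro ε hε
  obtain ⟨g, hgs, hfg, hgc, hgm⟩ := (Lp.memLp f).exists_hasCompactSupport_eLpNorm_sub_le hp
    (ε := ENNReal.ofReal (ε / 2)) (by simpa using hε)
  have hfgn : ‖f - hgm.toLp g‖ ≤ ε / 2 := by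
    rw [Lp.norm_def]
    refine ENNReal.toReal_le_of_le_ofReal (by positivity) (le_trans (le_of_eq ?_) hfg)
    refine eLpNorm_congr_ae ?_
    filter_upwards [Lp.coeFn_sub f (hgm.toLp g), hgm.coeFn_toLp] with x h1 h2
    rw [h1, Pi.sub_apply, h2, Pi.sub_apply]
  obtain ⟨R, hR⟩ := hgs.isCompact.isBounded.subset_closedBall 0
  obtain ⟨N, hN⟩ := exists_nat_gt R
  have hg0 : ∀ x, x ∉ Set.Ico (-(N : ℝ)) N → g x = 0 := by
    intro x hx
    by_contra h
    have h1 := hR (subset_tsupport g h)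
    rw [Metric.mem_closedBall, dist_zero_right, Real.norm_eq_abs, abs_le] at h1
    exact hx ⟨by linarith, by linarith⟩
  have hvol : volume (Set.Ico (-(N : ℝ)) N) ≠ ∞ := by simp
  set V := volume.real (Set.Ico (-(N : ℝ)) N) ^ (1 / p.toReal) with hV
  have hV0 : 0 ≤ V := by positivity
  set δ := ε / (2 * (V + 1)) with hδ
  have hδ0 : 0 < δ := by positivity
  obtain ⟨η, hη, hgη⟩ := Metric.uniformContinuous_iff.1
    (hgs.uniformContinuous_of_continuous hgc) δ hδ0
  obtain ⟨k, hk⟩ := exists_pow_lt_of_lt_one hη (by norm_num : (1 / 2 : ℝ) < 1)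
  let s : Lp ℝ p (volume : Measure ℝ) :=
    ∑ m ∈ Finset.Ico (-(N * 2 ^ k : ℤ)) (N * 2 ^ k), g (m / 2 ^ k) • dyadicLp p (-(k : ℤ), m)
  have hsM : s ∈ M := Submodule.sum_mem _ fun m _ =>
    Submodule.smul_mem _ _ (dyadicLp_mem_closure_span_haarLp hp1 hp _)
  have hsx : s =ᵐ[volume]
      (Set.Ico (-(N : ℝ)) N).indicator (fun x => g (⌊x * 2 ^ k⌋ / 2 ^ k)) := by
    have h1 : s =ᵐ[volume] fun x => ∑ m ∈ Finset.Ico (-(N * 2 ^ k : ℤ)) (N * 2 ^ k),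
        g (m / 2 ^ k) * (dyadicIco (-(k : ℤ), m)).indicator (fun _ => (1 : ℝ)) x := by
      simp only [s]
      generalize Finset.Ico (-(N * 2 ^ k : ℤ)) (N * 2 ^ k) = t
      induction t using Finset.induction_on with
      | empty =>
        simp only [Finset.sum_empty]
        exact Lp.coeFn_zero _ _ _
      | insert m t hm ih =>
        simp only [Finset.sum_insert hm]
        have h3 : dyadicLp p (-(k : ℤ), m) =ᵐ[volume] _ := indicatorConstLp_coeFn
        filter_upwards [Lp.coeFn_add (g (m / 2 ^ k) • dyadicLp p (-(k : ℤ), m))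
          (∑ m ∈ t, g (m / 2 ^ k) • dyadicLp p (-(k : ℤ), m)),
          Lp.coeFn_smul (g (m / 2 ^ k)) (dyadicLp p (-(k : ℤ), m)), h3, ih] with x h1 h2 h3 h4
        rw [h1, Pi.add_apply, h2, Pi.smul_apply, h3, h4, smul_eq_mul]
    refine h1.trans (Eventually.of_forall fun x => ?_)
    exact sum_indicator_dyadicIco g k N x
  have hgsn : ‖hgm.toLp g - s‖ ≤ δ * V := by
    have h1 : ‖indicatorConstLp p measurableSet_Ico hvol δ‖ = δ * V := by
      rw [norm_indicatorConstLp hp0 hp, Real.norm_of_nonneg hδ0.le]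
    rw [← h1]
    refine Lp.norm_le_norm_of_ae_le ?_
    have h2 : (indicatorConstLp p measurableSet_Ico hvol δ : Lp ℝ p (volume : Measure ℝ))
      =ᵐ[volume] _ := indicatorConstLp_coeFn
    filter_upwards [Lp.coeFn_sub (hgm.toLp g) s, hgm.coeFn_toLp, hsx, h2] with x e1 e2 e3 e4
    rw [e1, Pi.sub_apply, e2, e3, e4]
    by_cases hx : x ∈ Set.Ico (-(N : ℝ)) N
    · rw [Set.indicator_of_mem hx, Set.indicator_of_mem hx, Real.norm_of_nonneg hδ0.le,
        ← dist_eq_norm]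
      refine (hgη ?_).le
      have h2 : (0 : ℝ) < 2 ^ k := by positivity
      have h3 := Int.floor_le (x * 2 ^ k)
      have h4 := Int.lt_floor_add_one (x * 2 ^ k)
      have h5 : x - ⌊x * 2 ^ k⌋ / 2 ^ k = (x * 2 ^ k - ⌊x * 2 ^ k⌋) / 2 ^ k := by
        field_simp
      rw [Real.dist_eq, h5, abs_of_nonneg (div_nonneg (by linarith) h2.le)]
      refine lt_of_le_of_lt ?_ hk
      rw [one_div, inv_pow, ← one_div]
      exact div_le_div_of_nonneg_right (by linarith) h2.le
    · rw [Set.indicator_of_notMem hx, Set.indicator_of_notMem hx, hg0 x hx]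
      simp
  refine ⟨s, hsM, ?_⟩
  rw [dist_eq_norm]
  have h1 : f - s = (f - hgm.toLp g) + (hgm.toLp g - s) := by abel
  rw [h1]
  refine (norm_add_le _ _).trans_lt ?_
  have h2 : δ * V < ε / 2 := by
    have : δ * (V + 1) = ε / 2 := by rw [hδ]; field_simp
    linarith
  linarith

end HaarDense

section HaarSequence

variable {p : ℝ≥0∞} [Fact (1 ≤ p)]

/-- The normalized Haar functions of the line, in any order, form an unconditional basis of
`L_p`. -/
theorem exists_hasUnconditionalConstant_closedSpan_eq_top (hp : 2 < p) (hp_top : p ≠ ∞) :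
    ∃ (h : ℕ → Lp ℝ p (volume : Measure ℝ)) (K : ℝ), 1 ≤ K ∧ (∀ n, ‖h n‖ = 1) ∧
      HasUnconditionalConstant h K ∧ closedSpan h = ⊤ := by
  classical
  obtain ⟨C, hC, hsign⟩ := exists_haarLp_signs_bound hp hp_top
  let e : ℕ ≃ ℤ × ℤ := (Denumerable.eqv (ℤ × ℤ)).symm
  have hn : ∀ I, ‖haarLp p I‖ ≠ 0 := fun I => norm_ne_zero_iff.2 (haarLp_ne_zero I)
  let h : ℕ → Lp ℝ p (volume : Measure ℝ) := fun n => ‖haarLp p (e n)‖⁻¹ • haarLp p (e n)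
  refine ⟨h, C, hC, fun n => ?_, fun b N A hA => ?_, ?_⟩
  · rw [norm_smul, norm_inv, norm_norm, inv_mul_cancel₀ (hn _)]
  · let b' : ℤ × ℤ → ℝ := fun I => b (e.symm I) * ‖haarLp p I‖⁻¹
    let ε : ℤ × ℤ → ℝ := fun I => if e.symm I ∈ A then 1 else -1
    have h1 := hsign b' ε (fun I => by simp only [ε]; split_ifs <;> simp)
      ((Finset.range N).map e.toEmbedding)
    simp only [Finset.sum_map, Equiv.coe_toEmbedding, b', ε, Equiv.symm_apply_apply] at h1
    have h2 : ∑ n ∈ Finset.range N, (b n * ‖haarLp p (e n)‖⁻¹) • haarLp p (e n)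
        = ∑ n ∈ Finset.range N, b n • h n :=
      Finset.sum_congr rfl fun n _ => by simp only [h, smul_smul]
    rw [h2] at h1
    -- a coordinate projection is the average of the identity and a change of signs
    have h3 : ∑ n ∈ A, b n • h n = (1 / 2 : ℝ) • (∑ n ∈ Finset.range N, b n • h n +
        ∑ n ∈ Finset.range N, ((if n ∈ A then (1 : ℝ) else -1) * (b n * ‖haarLp p (e n)‖⁻¹)) •
          haarLp p (e n)) := by
      rw [← Finset.sum_add_distrib, Finset.smul_sum]
      refine Finset.sum_subset_zero_on_sdiff hA (fun n hn => ?_) (fun n hn => ?_)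
      · rw [if_neg (Finset.mem_sdiff.1 hn).2]
        simp only [h]
        module
      · rw [if_pos hn]
        simp only [h]
        module
    rw [h3, norm_smul, Real.norm_of_nonneg (by norm_num)]
    have h4 := norm_add_le (∑ n ∈ Finset.range N, b n • h n)
      (∑ n ∈ Finset.range N, ((if n ∈ A then (1 : ℝ) else -1) * (b n * ‖haarLp p (e n)‖⁻¹)) •
          haarLp p (e n))
    have h5 : ‖∑ n ∈ Finset.range N, b n • h n‖ ≤ C * ‖∑ n ∈ Finset.range N, b n • h n‖ :=
      le_mul_of_one_le_left (norm_nonneg _) hC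
    linarith
  · rw [eq_top_iff, ← closure_span_haarLp_eq_top (lt_trans (by norm_num) hp) hp_top]
    refine Submodule.topologicalClosure_mono (Submodule.span_le.2 ?_)
    rintro _ ⟨I, rfl⟩
    have h1 : haarLp p I = ‖haarLp p I‖ • h (e.symm I) := by
      simp only [h, Equiv.apply_symm_apply]
      rw [smul_smul, mul_inv_cancel₀ (hn I), one_smul]
    rw [h1]
    exact Submodule.smul_mem _ _ (Submodule.subset_span ⟨_, rfl⟩)

end HaarSequence

/-! ### Compression of the line into a bounded interval -/

section Compression

/-- The open interval on which `tan` is a diffeomorphism onto `ℝ`. -/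
noncomputable def tanInterval : Set ℝ := Set.Ioo (-(Real.pi / 2)) (Real.pi / 2)

lemma measurableSet_tanInterval : MeasurableSet tanInterval := measurableSet_Ioo

lemma lintegral_eq_lintegral_tan (g : ℝ → ℝ≥0∞) :
    ∫⁻ y, g y = ∫⁻ x in tanInterval, ENNReal.ofReal (1 / Real.cos x ^ 2) * g (Real.tan x) := by
  have h := lintegral_image_eq_lintegral_abs_deriv_mul (f := Real.tan)
    (f' := fun x => 1 / Real.cos x ^ 2) measurableSet_tanInterval
    (fun x hx => (Real.hasDerivAt_tan_of_mem_Ioo hx).hasDerivWithinAt) Real.injOn_tan g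
  rw [tanInterval, Real.image_tan_Ioo, Measure.restrict_univ] at h
  rw [h, tanInterval]
  refine lintegral_congr fun x => ?_
  rw [abs_of_nonneg (by positivity)]

lemma measurable_tan : Measurable Real.tan := by
  have : Real.tan = fun x => Real.sin x / Real.cos x := by
    funext x
    exact Real.tan_eq_sin_div_cos x
  rw [this]
  exact Real.measurable_sin.div Real.measurable_cos

lemma quasiMeasurePreserving_tan :
    Measure.QuasiMeasurePreserving Real.tan (volume.restrict tanInterval) volume := by
  refine ⟨measurable_tan, Measure.AbsolutelyContinuous.mk fun N hN h0 => ?_⟩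
  rw [Measure.map_apply measurable_tan hN, measure_eq_zero_iff_ae_notMem]
  have h := lintegral_eq_lintegral_tan (N.indicator fun _ => 1)
  rw [lintegral_indicator hN, setLIntegral_const, h0, mul_zero] at h
  have hm : Measurable fun x => ENNReal.ofReal (1 / Real.cos x ^ 2) *
      N.indicator (fun _ => (1 : ℝ≥0∞)) (Real.tan x) :=
    (by fun_prop : Measurable fun x => ENNReal.ofReal (1 / Real.cos x ^ 2)).mul
      ((measurable_const.indicator hN).comp measurable_tan)
  have h2 := (lintegral_eq_zero_iff hm).1 h.symm
  filter_upwards [h2, ae_restrict_mem measurableSet_tanInterval] with x hx hxs hxN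
  have hcos : 0 < Real.cos x := Real.cos_pos_of_mem_Ioo hxs
  have hx' : Real.tan x ∈ N := hxN
  simp only [Set.indicator_of_mem hx', mul_one, Pi.zero_apply, ENNReal.ofReal_eq_zero] at hx
  have : 0 < 1 / Real.cos x ^ 2 := by positivity
  linarith

variable {p : ℝ≥0∞} [Fact (1 ≤ p)]

/-- The change of variables `x ↦ tan x`, with the density that makes it isometric in `L_p`. -/
noncomputable def compress (p : ℝ≥0∞) (f : ℝ → ℝ) : ℝ → ℝ :=
  tanInterval.indicator fun x => (1 / Real.cos x ^ 2) ^ (1 / p.toReal) * f (Real.tan x)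

lemma eLpNorm_compress (hp : p ≠ ∞) (f : ℝ → ℝ) :
    eLpNorm (compress p f) p volume = eLpNorm f p volume := by
  have hp0 : p ≠ 0 := (zero_lt_one.trans_le (Fact.out : 1 ≤ p)).ne'
  have hq : 0 < p.toReal := ENNReal.toReal_pos hp0 hp
  rw [eLpNorm_eq_lintegral_rpow_enorm_toReal hp0 hp, eLpNorm_eq_lintegral_rpow_enorm_toReal hp0 hp]
  congr 1
  rw [lintegral_eq_lintegral_tan (fun y => ‖f y‖ₑ ^ p.toReal), ← lintegral_indicator measurableSet_tanInterval]
  refine lintegral_congr fun x => ?_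
  by_cases hx : x ∈ tanInterval
  · have hcos : 0 < Real.cos x := Real.cos_pos_of_mem_Ioo hx
    rw [compress, Set.indicator_of_mem hx, Set.indicator_of_mem hx, enorm_mul,
      ENNReal.mul_rpow_of_nonneg _ _ hq.le, Real.enorm_of_nonneg (by positivity),
      ENNReal.ofReal_rpow_of_nonneg (by positivity) hq.le, ← Real.rpow_mul (by positivity),
      one_div_mul_cancel hq.ne', Real.rpow_one]
  · rw [compress, Set.indicator_of_notMem hx, Set.indicator_of_notMem hx, enorm_zero,
      ENNReal.zero_rpow_of_pos hq]

lemma memLp_compress (hp : p ≠ ∞) {f : ℝ → ℝ} (hf : MemLp f p volume) :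
    MemLp (compress p f) p volume := by
  refine ⟨?_, ?_⟩
  · rw [compress, aestronglyMeasurable_indicator_iff measurableSet_tanInterval]
    refine AEStronglyMeasurable.mul ?_
      (hf.1.comp_quasiMeasurePreserving quasiMeasurePreserving_tan)
    exact (by fun_prop : Measurable fun x => (1 / Real.cos x ^ 2) ^ (1 / p.toReal)).aestronglyMeasurable
  · rw [eLpNorm_compress hp]
    exact hf.2

/-- `L_p(ℝ)` embeds isometrically into its subspace of functions supported in a bounded
interval. -/
theorem exists_linearIsometry_mem_LpSupp (hp : p ≠ ∞) :
    ∃ J : Lp ℝ p (volume : Measure ℝ) →ₗᵢ[ℝ] Lp ℝ p (volume : Measure ℝ),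
      ∀ f, J f ∈ LpSupp p (Set.Ioo (-2) 2) := by
  let J : Lp ℝ p (volume : Measure ℝ) → Lp ℝ p (volume : Measure ℝ) := fun f =>
    (memLp_compress hp (Lp.memLp f)).toLp (compress p f)
  have hJ : ∀ f, J f =ᵐ[volume] compress p f := fun f => MemLp.coeFn_toLp _
  have hae : ∀ P : ℝ → Prop, (∀ᵐ y, P y) → ∀ᵐ x, x ∈ tanInterval → P (Real.tan x) := by
    intro P hP
    exact (ae_restrict_iff' measurableSet_tanInterval).1 (quasiMeasurePreserving_tan.ae hP)
  refine ⟨⟨⟨⟨J, fun f g => ?_⟩, fun c f => ?_⟩, fun f => ?_⟩, fun f => ?_⟩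
  · apply Lp.ext
    filter_upwards [hJ (f + g), hJ f, hJ g, Lp.coeFn_add (J f) (J g),
      hae _ (Lp.coeFn_add f g)] with x h1 h2 h3 h4 h5
    rw [h1, h4, Pi.add_apply, h2, h3]
    by_cases hx : x ∈ tanInterval
    · simp only [compress, Set.indicator_of_mem hx]
      rw [h5 hx, Pi.add_apply, mul_add]
    · simp only [compress, Set.indicator_of_notMem hx, add_zero]
  · apply Lp.ext
    filter_upwards [hJ (c • f), hJ f, Lp.coeFn_smul c (J f), hae _ (Lp.coeFn_smul c f)]
      with x h1 h2 h4 h5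
    simp only [RingHom.id_apply]
    rw [h1, h4, Pi.smul_apply, h2]
    by_cases hx : x ∈ tanInterval
    · simp only [compress, Set.indicator_of_mem hx]
      rw [h5 hx, Pi.smul_apply, smul_eq_mul, smul_eq_mul]
      ring
    · simp only [compress, Set.indicator_of_notMem hx, smul_zero]
  · change ‖J f‖ = ‖f‖
    rw [Lp.norm_toLp, eLpNorm_compress hp, Lp.norm_def]
  · change J f ∈ _
    rw [mem_LpSupp_iff measurableSet_Ioo]
    filter_upwards [hJ f] with x h1 hx
    rw [h1, compress, Set.indicator_of_notMem]
    intro hx'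
    refine hx ⟨?_, ?_⟩
    · linarith [hx'.1, Real.pi_le_four]
    · linarith [hx'.2, Real.pi_le_four]

end Compression

/-! ### Realization of the trees by functions -/

section TreeVectors

variable {p : ℝ≥0∞} [Fact (1 ≤ p)]

lemma exists_norm_eq_one_mem_LpSupp (hp : p ≠ ∞) {a b : ℝ} (hab : a < b) :
    ∃ e ∈ LpSupp p (Set.Ioo a b), ‖e‖ = 1 := by
  have hp0 : p ≠ 0 := (zero_lt_one.trans_le (Fact.out : 1 ≤ p)).ne'
  have hvol : volume (Set.Ioo a b) ≠ ∞ := by simp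
  let v : Lp ℝ p (volume : Measure ℝ) := indicatorConstLp p measurableSet_Ioo hvol 1
  have hv : v ∈ LpSupp p (Set.Ioo a b) :=
    (mem_LpSupp_iff measurableSet_Ioo).2 indicatorConstLp_coeFn_notMem
  have hn : 0 < ‖v‖ := by
    rw [norm_indicatorConstLp hp0 hp, norm_one, one_mul, Real.volume_real_Ioo_of_le hab.le]
    have : 0 < b - a := sub_pos.2 hab
    positivity
  refine ⟨‖v‖⁻¹ • v, Submodule.smul_mem _ _ hv, ?_⟩
  rw [norm_smul, norm_inv, norm_norm, inv_mul_cancel₀ hn.ne']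

/-- Functions supported in a prescribed interval whose linear combinations have their norm given by
the tree sum. They are built by placing the two subtrees and the root in disjoint intervals. -/
theorem exists_norm_sum_rpow_eq_treeSum (hp : p ≠ ∞) {ρ : ℝ} (hρ : 0 ≤ ρ) (L : ℕ) :
    ∀ a b : ℝ, a < b → ∃ z : ℕ → Lp ℝ p (volume : Measure ℝ),
      (∀ i, z i ∈ LpSupp p (Set.Ioo a b)) ∧
      (∀ i, ‖z i‖ ≤ ∑ k ∈ Finset.range (L + 1), ρ ^ k) ∧
      ∀ c : ℕ → ℝ, ‖∑ i ∈ Finset.range (2 ^ L), c i • z i‖ ^ p.toReal =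
        treeSum p.toReal ρ L c := by
  have hp0 : p ≠ 0 := (zero_lt_one.trans_le (Fact.out : 1 ≤ p)).ne'
  have hq : 0 < p.toReal := ENNReal.toReal_pos hp0 hp
  induction L with
  | zero =>
    intro a b _
    refine ⟨fun _ => 0, fun _ => Submodule.zero_mem _, fun _ => by simp, fun c => ?_⟩
    simp [treeSum, Real.zero_rpow hq.ne']
  | succ L ih =>
    intro a b hab
    obtain ⟨d, hd, hdb⟩ : ∃ d, 0 < d ∧ a + 2 * d < b := ⟨(b - a) / 3, by linarith, by linarith⟩
    obtain ⟨zl, hzl, hzln, hzlT⟩ := ih a (a + d) (by linarith)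
    obtain ⟨zr, hzr, hzrn, hzrT⟩ := ih (a + d) (a + 2 * d) (by linarith)
    obtain ⟨e, he, hen⟩ := exists_norm_eq_one_mem_LpSupp hp hdb
    have hl : LpSupp p (Set.Ioo a (a + d)) ≤ LpSupp p (Set.Ioo a b) :=
      LpSupp_mono measurableSet_Ioo measurableSet_Ioo
        (Set.Ioo_subset_Ioo le_rfl (by linarith))
    have hr : LpSupp p (Set.Ioo (a + d) (a + 2 * d)) ≤ LpSupp p (Set.Ioo a b) :=
      LpSupp_mono measurableSet_Ioo measurableSet_Ioo
        (Set.Ioo_subset_Ioo (by linarith) (by linarith))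
    have he' : LpSupp p (Set.Ioo (a + 2 * d) b) ≤ LpSupp p (Set.Ioo a b) :=
      LpSupp_mono measurableSet_Ioo measurableSet_Ioo
        (Set.Ioo_subset_Ioo (by linarith) le_rfl)
    have hρe : ‖ρ ^ (L + 1) • e‖ = ρ ^ (L + 1) := by
      rw [norm_smul, hen, mul_one, Real.norm_of_nonneg (by positivity)]
    refine ⟨fun i => if i < 2 ^ L then zl i + ρ ^ (L + 1) • e
      else zr (i - 2 ^ L) - ρ ^ (L + 1) • e, fun i => ?_, fun i => ?_, fun c => ?_⟩
    · simp only
      split_ifs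
      · exact Submodule.add_mem _ (hl (hzl i)) (Submodule.smul_mem _ _ (he' he))
      · exact Submodule.sub_mem _ (hr (hzr _)) (Submodule.smul_mem _ _ (he' he))
    · simp only
      rw [Finset.sum_range_succ]
      split_ifs
      · exact (norm_add_le _ _).trans (add_le_add (hzln i) hρe.le)
      · exact (norm_sub_le _ _).trans (add_le_add (hzrn _) hρe.le)
    · set Xl := ∑ i ∈ Finset.range (2 ^ L), c i • zl i with hXl
      set Xr := ∑ i ∈ Finset.range (2 ^ L), c (2 ^ L + i) • zr i with hXr
      set w := ρ ^ (L + 1) * (∑ i ∈ Finset.range (2 ^ L), c i -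
        ∑ i ∈ Finset.range (2 ^ L), c (2 ^ L + i)) with hw
      have hsum : ∑ i ∈ Finset.range (2 ^ (L + 1)), c i • (if i < 2 ^ L then
          zl i + ρ ^ (L + 1) • e else zr (i - 2 ^ L) - ρ ^ (L + 1) • e) = (Xl + Xr) + w • e := by
        rw [pow_succ, mul_two, Finset.sum_range_add]
        have e1 : ∑ i ∈ Finset.range (2 ^ L), c i • (if i < 2 ^ L then
            zl i + ρ ^ (L + 1) • e else zr (i - 2 ^ L) - ρ ^ (L + 1) • e)
            = Xl + (ρ ^ (L + 1) * ∑ i ∈ Finset.range (2 ^ L), c i) • e := by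
          rw [Finset.mul_sum, Finset.sum_smul, hXl, ← Finset.sum_add_distrib]
          refine Finset.sum_congr rfl fun i hi => ?_
          rw [if_pos (Finset.mem_range.1 hi)]
          module
        have e2 : ∑ i ∈ Finset.range (2 ^ L), c (2 ^ L + i) • (if 2 ^ L + i < 2 ^ L then
            zl (2 ^ L + i) + ρ ^ (L + 1) • e else zr (2 ^ L + i - 2 ^ L) - ρ ^ (L + 1) • e)
            = Xr - (ρ ^ (L + 1) * ∑ i ∈ Finset.range (2 ^ L), c (2 ^ L + i)) • e := by
          rw [Finset.mul_sum, Finset.sum_smul, hXr, ← Finset.sum_sub_distrib]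
          refine Finset.sum_congr rfl fun i hi => ?_
          rw [if_neg (by omega), Nat.add_sub_cancel_left]
          module
        rw [e1, e2, hw]
        module
      have hXlm : Xl ∈ LpSupp p (Set.Ioo a (a + d)) :=
        Submodule.sum_mem _ fun i _ => Submodule.smul_mem _ _ (hzl i)
      have hXrm : Xr ∈ LpSupp p (Set.Ioo (a + d) (a + 2 * d)) :=
        Submodule.sum_mem _ fun i _ => Submodule.smul_mem _ _ (hzr i)
      have hXm : Xl + Xr ∈ LpSupp p (Set.Ioo a (a + 2 * d)) :=
        Submodule.add_mem _
          (LpSupp_mono measurableSet_Ioo measurableSet_Ioo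
            (Set.Ioo_subset_Ioo le_rfl (by linarith)) hXlm)
          (LpSupp_mono measurableSet_Ioo measurableSet_Ioo
            (Set.Ioo_subset_Ioo (by linarith) le_rfl) hXrm)
      have hdis : ∀ x y z : ℝ, Disjoint (Set.Ioo x y) (Set.Ioo y z) := fun x y z =>
        Set.disjoint_left.2 fun t ht ht' => by linarith [ht.2, ht'.1]
      rw [hsum, norm_add_rpow_of_disjoint hp measurableSet_Ioo measurableSet_Ioo (hdis _ _ _) hXm
        (Submodule.smul_mem _ w he), norm_add_rpow_of_disjoint hp measurableSet_Ioo
        measurableSet_Ioo (hdis _ _ _) hXlm hXrm, hXl, hXr, hzlT, hzrT (fun i => c (2 ^ L + i)),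
        norm_smul, hen, mul_one, Real.norm_eq_abs]
      rfl

end TreeVectors

/-! ### Translates by powers of three -/

section PowThree

lemma pow_three_add_pow_three_eq {a b c d : ℕ} (h : 3 ^ a + 3 ^ d = 3 ^ c + 3 ^ b) (hab : a ≠ b) :
    a = c ∧ d = b := by
  have key : ∀ {x y z w : ℕ}, 3 ^ x + 3 ^ y = 3 ^ z + 3 ^ w → z ≤ x ∨ z ≤ y := by
    intro x y z w hxy
    by_contra! hcon
    have h1 := Nat.pow_le_pow_right (n := 3) (by norm_num) (Nat.succ_le_of_lt hcon.1)
    have h2 := Nat.pow_le_pow_right (n := 3) (by norm_num) (Nat.succ_le_of_lt hcon.2)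
    have h3 : 0 < 3 ^ w := by positivity
    have h4 : 0 < 3 ^ z := by positivity
    rw [Nat.succ_eq_add_one, pow_succ] at h1 h2
    omega
  have h1 := key h
  have h2 := key (h.trans (add_comm _ _))
  have h3 := key h.symm
  have h4 := key (h.symm.trans (add_comm _ _))
  have hinj : ∀ {x y : ℕ}, 3 ^ x = 3 ^ y → x = y := fun hxy =>
    Nat.pow_right_injective (le_refl 2 |>.trans (by norm_num)) hxy
  by_cases hac : a = c
  · subst hac
    exact ⟨rfl, hinj (by omega)⟩
  · by_cases hdb : d = b
    · subst hdb
      exact ⟨hinj (by omega), rfl⟩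
    · by_cases hdc : d = c
      · subst hdc
        exact absurd (hinj (by omega)) hab
      · omega

/-- The position at which the translate number `i` shows the `j`-th piece of the function. -/
def powThreeShift (i j : ℕ) : ℤ := 3 ^ (j + 1) - 3 ^ (i + 1)

lemma six_dvd_powThreeShift (i j : ℕ) : (6 : ℤ) ∣ powThreeShift i j := by
  have h : ∀ n : ℕ, (3 : ℤ) ^ (n + 1) % 6 = 3 := by
    intro n
    induction n with
    | zero => norm_num
    | succ n ih => rw [pow_succ, Int.mul_emod, ih]; norm_num
  have h1 := h i
  have h2 := h j
  rw [powThreeShift]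
  omega

lemma powThreeShift_inj {i j i' j' : ℕ} (hij : i ≠ j)
    (h : powThreeShift i j = powThreeShift i' j') : i = i' ∧ j = j' := by
  have h1 : 3 ^ (j + 1) + 3 ^ (i' + 1) = 3 ^ (j' + 1) + 3 ^ (i + 1) := by
    zify
    simp only [powThreeShift] at h
    linarith
  have h2 := pow_three_add_pow_three_eq h1 (by omega)
  omega

lemma powThreeShift_ne_zero {i j : ℕ} (hij : i ≠ j) : powThreeShift i j ≠ 0 := by
  intro h
  have := powThreeShift_inj (i' := j) (j' := j) hij (by rw [h]; simp [powThreeShift])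
  exact hij this.1

lemma disjoint_Ioo_of_six_dvd {a b : ℤ} (h : (6 : ℤ) ∣ a - b) (hab : a ≠ b) :
    Disjoint (Set.Ioo ((a : ℝ) - 3) (a + 3)) (Set.Ioo ((b : ℝ) - 3) (b + 3)) := by
  rw [Set.disjoint_left]
  intro x hx hx'
  have h1 : a - b < 6 := by
    have : (a : ℝ) - b < 6 := by linarith [hx.1, hx'.2]
    exact_mod_cast this
  have h2 : -6 < a - b := by
    have : (-6 : ℝ) < a - b := by linarith [hx.2, hx'.1]
    exact_mod_cast this
  omega

/-- The union of the windows, other than the central one, in which the translate number `i` is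
supported. -/
def powThreeTail (i : ℕ) : Set ℝ :=
  ⋃ (j : ℕ) (_ : j ≠ i), Set.Ioo ((powThreeShift i j : ℝ) - 3) (powThreeShift i j + 3)

lemma measurableSet_powThreeTail (i : ℕ) : MeasurableSet (powThreeTail i) :=
  MeasurableSet.iUnion fun _ => MeasurableSet.iUnion fun _ => measurableSet_Ioo

lemma disjoint_Ioo_powThreeTail (i : ℕ) : Disjoint (Set.Ioo (-3 : ℝ) 3) (powThreeTail i) := by
  simp only [powThreeTail, Set.disjoint_iUnion_right]
  intro j hj
  have h := disjoint_Ioo_of_six_dvd (a := 0) (b := powThreeShift i j)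
    (by simpa using six_dvd_powThreeShift i j) (powThreeShift_ne_zero hj.symm).symm
  simpa using h

lemma pairwise_disjoint_powThreeTail : Pairwise (Function.onFun Disjoint powThreeTail) := by
  intro i i' hii
  simp only [Function.onFun, powThreeTail, Set.disjoint_iUnion_right, Set.disjoint_iUnion_left]
  intro j hj j' hj'
  refine disjoint_Ioo_of_six_dvd
    (dvd_sub (six_dvd_powThreeShift _ _) (six_dvd_powThreeShift _ _)) fun h => ?_
  exact hii (powThreeShift_inj hj'.symm h).1

variable {p : ℝ≥0∞} [Fact (1 ≤ p)]

/-- A single function whose translates restrict to prescribed functions on the window `(-3, 3)` and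
have disjoint supports off the window. -/
theorem exists_powThreeTranslates_eq_add (hp : p ≠ ∞) {g : ℕ → Lp ℝ p (volume : Measure ℝ)}
    (hg : ∀ j, g j ∈ LpSupp p (Set.Ioo (-3) 3)) (hs : Summable fun j => ‖g j‖ ^ p.toReal) :
    ∃ (f : Lp ℝ p (volume : Measure ℝ)) (r : ℕ → Lp ℝ p (volume : Measure ℝ)),
      (∀ i, powThreeTranslates p f i = g i + r i) ∧ ∀ i, r i ∈ LpSupp p (powThreeTail i) := by
  have hpre : ∀ l : ℝ, (fun x => x - l) ⁻¹' Set.Ioo (-3 : ℝ) 3 = Set.Ioo (l - 3) (l + 3) := by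
    intro l
    ext x
    simp only [Set.mem_preimage, Set.mem_Ioo]
    constructor <;> rintro ⟨h1, h2⟩ <;> constructor <;> linarith
  have hT : ∀ (l : ℝ) j, lpTranslate p l (g j) ∈ LpSupp p (Set.Ioo (l - 3) (l + 3)) := by
    intro l j
    rw [← hpre]
    exact lpTranslate_mem_LpSupp measurableSet_Ioo l (hg j)
  have hsum : Summable fun j : ℕ => lpTranslate p ((3 : ℝ) ^ (j + 1)) (g j) := by
    refine summable_of_disjoint hp
      (A := fun j : ℕ => Set.Ioo ((3 : ℝ) ^ (j + 1) - 3) ((3 : ℝ) ^ (j + 1) + 3))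
      (fun _ => measurableSet_Ioo) ?_ (fun j => hT _ j) ?_
    · intro i j hij
      have h := disjoint_Ioo_of_six_dvd (a := 3 ^ (i + 1)) (b := 3 ^ (j + 1))
        (six_dvd_powThreeShift j i) (sub_ne_zero.1 (powThreeShift_ne_zero hij.symm))
      push_cast at h
      exact h
    · simpa only [LinearIsometry.norm_map] using hs
  refine ⟨∑' j, lpTranslate p ((3 : ℝ) ^ (j + 1)) (g j), fun i =>
    ∑' j, if j = i then 0 else lpTranslate p (powThreeShift i j) (g j), fun i => ?_, fun i => ?_⟩
  · have h1 : HasSum (fun j : ℕ => lpTranslate p (powThreeShift i j) (g j))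
        (powThreeTranslates p (∑' j, lpTranslate p ((3 : ℝ) ^ (j + 1)) (g j)) i) := by
      have h := hsum.hasSum.map (lpTranslate p (-(3 : ℝ) ^ (i + 1)))
        (lpTranslate p (-(3 : ℝ) ^ (i + 1))).continuous
      refine h.congr_fun fun j => ?_
      rw [Function.comp_apply, lpTranslate_lpTranslate]
      congr 2
      simp only [powThreeShift]
      push_cast
      ring
    rw [← h1.tsum_eq, h1.summable.tsum_eq_add_tsum_ite i]
    congr 1
    have h0 : ((powThreeShift i i : ℤ) : ℝ) = 0 := by simp [powThreeShift]
    rw [h0, lpTranslate_zero]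
  · refine tsum_mem_LpSupp fun j => ?_
    split_ifs with hj
    · exact Submodule.zero_mem _
    · exact LpSupp_mono measurableSet_Ioo (measurableSet_powThreeTail i)
        (Set.subset_iUnion₂_of_subset j hj subset_rfl) (hT _ j)

end PowThree

/-! ### The construction -/

section Construction

/-- The decay rates of the construction: `γ ^ n` is the size of the functions of block `n`. The
first sum condition makes the `2 ^ n` functions of the blocks summable in `ℓ_q`, the second one
makes the flat average in a block, normalized to have norm one in the direction `h n`, small in
`ℓ_q`. -/
lemma exists_tree_parameters {q : ℝ} (hq : 2 < q) :
    ∃ ρ γ : ℝ, 1 / 2 < ρ ∧ ρ < 1 ∧ 0 < γ ∧ 2 * γ ^ q < 1 ∧ 2 ^ (1 / q) / (2 * γ * ρ) < 1 := by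
  have hq1 : 1 / q < 1 / 2 := one_div_lt_one_div_of_lt (by norm_num) hq
  have hq0 : 0 < 1 / q := by positivity
  have h1 : ∀ x : ℝ, x < 0 → (2 : ℝ) ^ x < 1 := fun x hx =>
    Real.rpow_lt_one_of_one_lt_of_neg (by norm_num) hx
  refine ⟨2 ^ (-(1 / 2 - 1 / q)), 2 ^ (-((1 / q + 1 / 2) / 2)), ?_, h1 _ (by linarith),
    by positivity, ?_, ?_⟩
  · have : (1 / 2 : ℝ) = 2 ^ (-1 : ℝ) := by rw [Real.rpow_neg_one]; norm_num
    rw [this]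
    exact Real.rpow_lt_rpow_of_exponent_lt (by norm_num) (by linarith)
  · rw [← Real.rpow_mul (by norm_num)]
    nth_rewrite 1 [← Real.rpow_one 2]
    rw [← Real.rpow_add (by norm_num)]
    refine h1 _ ?_
    have : 1 / q * q = 1 := one_div_mul_cancel (by linarith)
    nlinarith
  · nth_rewrite 2 [← Real.rpow_one 2]
    rw [← Real.rpow_add (by norm_num), ← Real.rpow_add (by norm_num),
      ← Real.rpow_sub (by norm_num)]
    refine h1 _ ?_
    linarith

variable {p : ℝ≥0∞} [Fact (1 ≤ p)]

/-- Functions `g i` in a bounded window with summable norms, of which the function number `i` of the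
dyadic block `n` is `γ ^ n` times the sum of `ρ ^ n * h n` and of a vertex function of the tree of
that block. -/
lemma exists_window_functions (hp : p ≠ ∞) {ρ γ : ℝ} (hρ0 : 0 ≤ ρ) (hρ1 : ρ < 1) (hγ : 0 < γ)
    (hγ1 : 2 * γ ^ p.toReal < 1) {h : ℕ → Lp ℝ p (volume : Measure ℝ)} (hh1 : ∀ n, ‖h n‖ = 1)
    (hh : ∀ n, h n ∈ LpSupp p (Set.Ioo (-2) 2)) :
    ∃ g : ℕ → Lp ℝ p (volume : Measure ℝ), (∀ i, g i ∈ LpSupp p (Set.Ioo (-3) 3)) ∧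
      (Summable fun i => ‖g i‖ ^ p.toReal) ∧
      (∀ (a : ℕ → ℝ) (N : ℕ), ‖∑ i ∈ Finset.range (2 ^ N - 1), a i • g i‖ ^ p.toReal =
        ‖∑ n ∈ Finset.range N,
          (γ ^ n * (ρ ^ n * ∑ i ∈ Finset.range (2 ^ n), a (2 ^ n - 1 + i))) • h n‖ ^ p.toReal +
        ∑ n ∈ Finset.range N,
          (γ ^ n) ^ p.toReal * treeSum p.toReal ρ n (fun i => a (2 ^ n - 1 + i))) ∧
      ∀ n, ∑ i ∈ Finset.range (2 ^ n), g (2 ^ n - 1 + i) = (γ ^ n * (ρ ^ n * 2 ^ n)) • h n := by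
  have hp0 : p ≠ 0 := (zero_lt_one.trans_le (Fact.out : 1 ≤ p)).ne'
  have hq : 0 < p.toReal := ENNReal.toReal_pos hp0 hp
  -- disjoint intervals in `(2, 3)` for the trees of the blocks
  let α : ℕ → ℝ := fun n => 2 + 1 / ((n : ℝ) + 2)
  let β : ℕ → ℝ := fun n => 2 + 1 / ((n : ℝ) + 1)
  have hαβ : ∀ n, α n < β n := fun n => by
    have : 1 / ((n : ℝ) + 2) < 1 / ((n : ℝ) + 1) :=
      one_div_lt_one_div_of_lt (by positivity) (by linarith)
    simp only [α, β]
    linarith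
  have hα2 : ∀ n, 2 ≤ α n := fun n => by
    have : 0 ≤ 1 / ((n : ℝ) + 2) := by positivity
    simp only [α]
    linarith
  have hβ3 : ∀ n, β n ≤ 3 := fun n => by
    have : 1 / ((n : ℝ) + 1) ≤ 1 := by
      rw [div_le_one (by positivity)]
      have : (0 : ℝ) ≤ n := Nat.cast_nonneg n
      linarith
    simp only [β]
    linarith
  have hdis' : ∀ n m : ℕ, n < m → β m ≤ α n := fun n m hnm => by
    have h1 : (n : ℝ) + 1 ≤ m := by exact_mod_cast hnm
    have : 1 / ((m : ℝ) + 1) ≤ 1 / ((n : ℝ) + 2) :=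
      one_div_le_one_div_of_le (by positivity) (by linarith)
    simp only [α, β]
    linarith
  have hdis : Pairwise (Function.onFun Disjoint fun n => Set.Ioo (α n) (β n)) := by
    intro n m hnm
    rw [Function.onFun, Set.disjoint_left]
    intro x hx hx'
    rcases lt_or_gt_of_ne hnm with h | h
    · linarith [hdis' n m h, hx.1, hx'.2]
    · linarith [hdis' m n h, hx.2, hx'.1]
  choose Z hZs hZn hZT using fun n =>
    exists_norm_sum_rpow_eq_treeSum hp hρ0 n (α n) (β n) (hαβ n)
  let g : ℕ → Lp ℝ p (volume : Measure ℝ) := fun i =>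
    γ ^ (Nat.log 2 (i + 1)) • (ρ ^ (Nat.log 2 (i + 1)) • h (Nat.log 2 (i + 1)) +
      Z (Nat.log 2 (i + 1)) (i + 1 - 2 ^ Nat.log 2 (i + 1)))
  have hgn : ∀ n i, i < 2 ^ n → g (2 ^ n - 1 + i) = γ ^ n • (ρ ^ n • h n + Z n i) := by
    intro n i hi
    have h1 := Nat.one_le_two_pow (n := n)
    have h2 : 2 ^ n - 1 + i + 1 - 2 ^ n = i := by omega
    simp only [g, log_two_pow_sub_one_add hi, h2]
  have hblock : ∀ (a : ℕ → ℝ) n, ∑ i ∈ Finset.range (2 ^ n), a (2 ^ n - 1 + i) • g (2 ^ n - 1 + i)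
      = (γ ^ n * (ρ ^ n * ∑ i ∈ Finset.range (2 ^ n), a (2 ^ n - 1 + i))) • h n +
        γ ^ n • ∑ i ∈ Finset.range (2 ^ n), a (2 ^ n - 1 + i) • Z n i := by
    intro a n
    rw [Finset.mul_sum, Finset.mul_sum, Finset.sum_smul, Finset.smul_sum,
      ← Finset.sum_add_distrib]
    refine Finset.sum_congr rfl fun i hi => ?_
    rw [hgn n i (Finset.mem_range.1 hi)]
    module
  have hZsum : ∀ (a : ℕ → ℝ) n, γ ^ n • ∑ i ∈ Finset.range (2 ^ n), a i • Z n i ∈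
      LpSupp p (Set.Ioo (α n) (β n)) := fun a n =>
    Submodule.smul_mem _ _ (Submodule.sum_mem _ fun i _ => Submodule.smul_mem _ _ (hZs n i))
  have hZnorm : ∀ (a : ℕ → ℝ) n, ‖γ ^ n • ∑ i ∈ Finset.range (2 ^ n), a i • Z n i‖ ^ p.toReal =
      (γ ^ n) ^ p.toReal * treeSum p.toReal ρ n a := by
    intro a n
    rw [norm_smul, Real.mul_rpow (norm_nonneg _) (norm_nonneg _), hZT,
      Real.norm_of_nonneg (by positivity)]
  refine ⟨g, fun i => ?_, ?_, fun a N => ?_, fun n => ?_⟩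
  · refine Submodule.smul_mem _ _ (Submodule.add_mem _ (Submodule.smul_mem _ _ ?_) ?_)
    · exact LpSupp_mono measurableSet_Ioo measurableSet_Ioo
        (Set.Ioo_subset_Ioo (by norm_num) (by norm_num)) (hh _)
    · refine LpSupp_mono measurableSet_Ioo measurableSet_Ioo
        (Set.Ioo_subset_Ioo ?_ (hβ3 _)) (hZs _ _)
      linarith [hα2 (Nat.log 2 (i + 1))]
  · set G : ℝ := 1 + (1 - ρ)⁻¹ with hG
    have hρ1' : 0 < 1 - ρ := by linarith
    have hG0 : 0 ≤ G := by positivity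
    have hgnorm : ∀ n i, i < 2 ^ n → ‖g (2 ^ n - 1 + i)‖ ^ p.toReal ≤
        (γ ^ p.toReal) ^ n * G ^ p.toReal := by
      intro n i hi
      have e1 : (γ ^ p.toReal) ^ n = (γ ^ n) ^ p.toReal := by
        rw [← Real.rpow_natCast, ← Real.rpow_natCast, ← Real.rpow_mul hγ.le,
          ← Real.rpow_mul hγ.le, mul_comm]
      rw [e1, ← Real.mul_rpow (by positivity) hG0]
      refine Real.rpow_le_rpow (norm_nonneg _) ?_ hq.le
      rw [hgn n i hi, norm_smul, Real.norm_of_nonneg (by positivity)]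
      refine mul_le_mul_of_nonneg_left ((norm_add_le _ _).trans (add_le_add ?_ ?_)) (by positivity)
      · rw [norm_smul, hh1, mul_one, Real.norm_of_nonneg (by positivity)]
        exact pow_le_one₀ hρ0 hρ1.le
      · refine (hZn n i).trans ?_
        rw [← tsum_geometric_of_lt_one hρ0 hρ1]
        exact (summable_geometric_of_lt_one hρ0 hρ1).sum_le_tsum _ fun k _ => by positivity
    refine summable_of_sum_range_le (c := (1 - 2 * γ ^ p.toReal)⁻¹ * G ^ p.toReal)
      (fun i => by positivity) fun N => ?_
    have hN : Finset.range N ⊆ Finset.range (2 ^ N - 1) := by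
      have := Nat.lt_two_pow_self (n := N)
      simp only [Finset.range_subset_range]
      omega
    refine (Finset.sum_le_sum_of_subset_of_nonneg hN fun i _ _ => by positivity).trans ?_
    rw [sum_range_two_pow_sub_one]
    have h2γ : 0 ≤ 2 * γ ^ p.toReal := by positivity
    calc _ ≤ ∑ n ∈ Finset.range N, ∑ _i ∈ Finset.range (2 ^ n),
            (γ ^ p.toReal) ^ n * G ^ p.toReal :=
          Finset.sum_le_sum fun n _ => Finset.sum_le_sum fun i hi =>
            hgnorm n i (Finset.mem_range.1 hi)
      _ = (∑ n ∈ Finset.range N, (2 * γ ^ p.toReal) ^ n) * G ^ p.toReal := by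
          rw [Finset.sum_mul]
          refine Finset.sum_congr rfl fun n _ => ?_
          rw [Finset.sum_const, Finset.card_range, nsmul_eq_mul, mul_pow]
          push_cast
          ring
      _ ≤ _ := by
          refine mul_le_mul_of_nonneg_right ?_ (by positivity)
          rw [← tsum_geometric_of_lt_one h2γ hγ1]
          exact (summable_geometric_of_lt_one h2γ hγ1).sum_le_tsum _ fun k _ => by positivity
  · have hU : MeasurableSet (⋃ n, Set.Ioo (α n) (β n)) :=
      MeasurableSet.iUnion fun _ => measurableSet_Ioo
    rw [sum_range_two_pow_sub_one, Finset.sum_congr rfl fun n _ => hblock a n,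
      Finset.sum_add_distrib,
      norm_add_rpow_of_disjoint hp (A := Set.Ioo (-2) 2) (B := ⋃ n, Set.Ioo (α n) (β n))
        measurableSet_Ioo hU,
      norm_sum_rpow_of_disjoint hp (A := fun n => Set.Ioo (α n) (β n))
        (fun _ => measurableSet_Ioo) hdis (fun n => hZsum (fun i => a (2 ^ n - 1 + i)) n)]
    · simp only [fun n => hZnorm (fun i => a (2 ^ n - 1 + i)) n]
    · simp only [Set.disjoint_iUnion_right]
      intro n
      rw [Set.disjoint_left]
      intro x hx hx'
      linarith [hx.2, hx'.1, hα2 n]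
    · exact Submodule.sum_mem _ fun n _ => Submodule.smul_mem _ _ (hh n)
    · exact Submodule.sum_mem _ fun n _ => LpSupp_mono measurableSet_Ioo hU
        (Set.subset_iUnion_of_subset n subset_rfl) (hZsum (fun i => a (2 ^ n - 1 + i)) n)
  · have h1 := hblock (fun _ => 1) n
    have h2 := hZnorm (fun _ => 1) n
    rw [treeSum_const hq, mul_zero, Real.rpow_eq_zero (norm_nonneg _) hq.ne', norm_eq_zero] at h2
    rw [h2, add_zero] at h1
    simpa using h1

end Construction

theorem propositionP (p : ℝ≥0∞) [Fact (1 ≤ p)] (hp : 2 < p) (hp_top : p < ∞) :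
    ∃ f : Lp ℝ p (volume : Measure ℝ),
      IsBasicSequence (powThreeTranslates p f) ∧
      EmbedsIsomorphically (Lp ℝ p (volume : Measure ℝ)) (closedSpan (powThreeTranslates p f)) ∧
      CanBeBlockedIntoUnconditionalFDD (powThreeTranslates p f) := by
  have hp2 := hp
  replace hp := hp_top.ne
  have hp0 : p ≠ 0 := (zero_lt_one.trans_le (Fact.out : 1 ≤ p)).ne'
  have hq2 : 2 < p.toReal := by
    have := (ENNReal.toReal_lt_toReal (by norm_num) hp).2 hp2
    simpa using this
  have hq : 0 < p.toReal := by linarith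
  obtain ⟨ρ, γ, hρ, hρ1, hγ, hγ1, hγ2⟩ := exists_tree_parameters hq2
  have hρ0 : 0 < ρ := by linarith
  obtain ⟨H, K, hK, hH1, hHK, hHtop⟩ := exists_hasUnconditionalConstant_closedSpan_eq_top hp2 hp
  obtain ⟨J, hJ⟩ := exists_linearIsometry_mem_LpSupp hp
  have hJH1 : ∀ n, ‖J (H n)‖ = 1 := fun n => by rw [J.norm_map, hH1]
  have hJHK : HasUnconditionalConstant (fun n => J (H n)) K := by
    intro b N A hA
    have h := hHK b N A hA
    rw [← J.norm_map, ← J.norm_map (∑ n ∈ Finset.range N, b n • H n)] at h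
    simpa only [map_sum, map_smul] using h
  obtain ⟨g, hg, hgs, hgT, hgflat⟩ :=
    exists_window_functions hp hρ0.le hρ1 hγ hγ1 hJH1 (fun n => hJ (H n))
  obtain ⟨f, r, hfr, hr⟩ := exists_powThreeTranslates_eq_add hp hg hgs
  set u := powThreeTranslates p f with hu
  have hun : ∀ i, ‖u i‖ = ‖f‖ := fun i => (lpTranslate p _).norm_map f
  have hTm : MeasurableSet (⋃ i, powThreeTail i) :=
    MeasurableSet.iUnion measurableSet_powThreeTail
  have hWT : Disjoint (Set.Ioo (-3 : ℝ) 3) (⋃ i, powThreeTail i) := by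
    simp only [Set.disjoint_iUnion_right]
    exact disjoint_Ioo_powThreeTail
  have hrT : ∀ i, r i ∈ LpSupp p (⋃ i, powThreeTail i) := fun i =>
    LpSupp_mono (measurableSet_powThreeTail i) hTm
      (Set.subset_iUnion_of_subset i subset_rfl) (hr i)
  have hufr : ∀ i, ‖u i‖ ^ p.toReal = ‖g i‖ ^ p.toReal + ‖r i‖ ^ p.toReal := fun i => by
    rw [hfr, norm_add_rpow_of_disjoint hp measurableSet_Ioo hTm hWT (hg i) (hrT i)]
  have hrsum : ∀ (a : ℕ → ℝ) (s : Finset ℕ), ‖∑ i ∈ s, a i • r i‖ ^ p.toReal =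
      ∑ i ∈ s, |a i| ^ p.toReal * ‖r i‖ ^ p.toReal := by
    intro a s
    rw [norm_sum_rpow_of_disjoint hp measurableSet_powThreeTail pairwise_disjoint_powThreeTail
      (fun i => Submodule.smul_mem _ (a i) (hr i))]
    refine Finset.sum_congr rfl fun i _ => ?_
    rw [norm_smul, Real.mul_rpow (norm_nonneg _) (norm_nonneg _), Real.norm_eq_abs]
  have htree : HasTreeNorm p.toReal ρ (fun n => γ ^ n) (fun i => ‖r i‖ ^ p.toReal)
      (fun n => J (H n)) u := by
    intro a N
    have h1 : ∑ i ∈ Finset.range (2 ^ N - 1), a i • u i =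
        ∑ i ∈ Finset.range (2 ^ N - 1), a i • g i + ∑ i ∈ Finset.range (2 ^ N - 1), a i • r i := by
      rw [← Finset.sum_add_distrib]
      exact Finset.sum_congr rfl fun i _ => by rw [hfr, smul_add]
    rw [h1, norm_add_rpow_of_disjoint hp measurableSet_Ioo hTm hWT
      (Submodule.sum_mem _ fun i _ => Submodule.smul_mem _ _ (hg i))
      (Submodule.sum_mem _ fun i _ => Submodule.smul_mem _ _ (hrT i)), hgT, hrsum]
  have hu0 : ∀ i, u i ≠ 0 := by
    -- all translates have the same norm, and the first one does not vanish on the window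
    have h0 : u 0 ≠ 0 := by
      intro h
      have h1 := hgflat 0
      simp only [pow_zero, Finset.range_one, Finset.sum_singleton, mul_one, one_smul,
        Nat.sub_self, add_zero] at h1
      have h2 := hufr 0
      rw [h, h1, hJH1, norm_zero, Real.zero_rpow hq.ne', Real.one_rpow] at h2
      have : 0 ≤ ‖r 0‖ ^ p.toReal := by positivity
      linarith
    intro i
    rw [← norm_ne_zero_iff, hun, ← hun 0, norm_ne_zero_iff]
    exact h0
  have hR0 : ∀ i, 0 ≤ ‖r i‖ ^ p.toReal := fun i => by positivity
  have hc0 : ∀ n : ℕ, 0 ≤ γ ^ n := fun n => by positivity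
  obtain ⟨K', hK'⟩ := htree.exists_hasBasisConstant (by linarith) hρ hρ1 hc0 hR0 hK hJHK hJH1
  obtain ⟨C, hC⟩ := htree.exists_block_bound (by linarith) hc0 hR0 hK hJHK
  refine ⟨f, hK'.isBasicSequence hu0, ?_, ?_⟩
  · -- the flat averages in the blocks are a small perturbation of the functions `J (H n)`
    obtain ⟨φ, hφ, hφn, -⟩ := hHK.hasBasisConstant.exists_coord
      (fun n => norm_ne_zero_iff.1 (by rw [hH1]; exact one_ne_zero))
    let κ : ℕ → ℝ := fun n => (γ ^ n * (ρ ^ n * 2 ^ n))⁻¹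
    have hκ0 : ∀ n, γ ^ n * (ρ ^ n * 2 ^ n) ≠ 0 := fun n => by positivity
    let t : ℕ → Lp ℝ p (volume : Measure ℝ) := fun n =>
      ∑ i ∈ Finset.range (2 ^ n), κ n • r (2 ^ n - 1 + i)
    have htT : ∀ n, t n ∈ LpSupp p (⋃ i, powThreeTail i) := fun n =>
      Submodule.sum_mem _ fun i _ => Submodule.smul_mem _ _ (hrT _)
    have hJt : ∀ n, J (H n) + t n = κ n • ∑ i ∈ Finset.range (2 ^ n), u (2 ^ n - 1 + i) := by
      intro n
      simp only [hfr, Finset.sum_add_distrib, hgflat, smul_add, t, Finset.smul_sum]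
      rw [smul_smul, inv_mul_cancel₀ (hκ0 n), one_smul]
    have htn : ∀ n, ‖t n‖ ≤ (2 ^ (1 / p.toReal) / (2 * γ * ρ)) ^ n * ‖f‖ := by
      intro n
      have h1 : ‖t n‖ ^ p.toReal ≤ 2 ^ n * (κ n * ‖f‖) ^ p.toReal := by
        have hinj : ∑ i ∈ (Finset.range (2 ^ n)).image (fun i => 2 ^ n - 1 + i), κ n • r i = t n := by
          rw [Finset.sum_image (fun x _ y _ hxy => by simpa using hxy)]
        rw [← hinj, hrsum (fun _ => κ n), Finset.sum_image (fun x _ y _ hxy => by simpa using hxy)]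
        refine (Finset.sum_le_card_nsmul _ _ ((κ n * ‖f‖) ^ p.toReal) fun i _ => ?_).trans
          (le_of_eq ?_)
        · have hκn : 0 ≤ κ n := by positivity
          rw [Real.mul_rpow hκn (norm_nonneg _), abs_of_nonneg hκn]
          refine mul_le_mul_of_nonneg_left ?_ (by positivity)
          rw [← hun (2 ^ n - 1 + i), hufr]
          have : 0 ≤ ‖g (2 ^ n - 1 + i)‖ ^ p.toReal := by positivity
          linarith
        · rw [Finset.card_range, nsmul_eq_mul]
          push_cast
          rfl
      have h2 := le_rpow_mul_of_rpow_le hq (norm_nonneg _) (by positivity) (by positivity) h1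
      refine h2.trans (le_of_eq ?_)
      rw [← Real.rpow_natCast, ← Real.rpow_mul (by norm_num), mul_comm (n : ℝ),
        Real.rpow_mul (by norm_num), Real.rpow_natCast]
      simp only [κ]
      rw [div_pow, mul_pow, mul_pow]
      ring
    let T : ℕ → (Lp ℝ p (volume : Measure ℝ) →L[ℝ] Lp ℝ p (volume : Measure ℝ)) := fun n =>
      (φ n).smulRight (t n)
    have hTs : Summable T := by
      refine Summable.of_norm_bounded (g := fun n =>
        (2 * K) * ((2 ^ (1 / p.toReal) / (2 * γ * ρ)) ^ n * ‖f‖)) ?_ fun n => ?_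
      · exact ((summable_geometric_of_lt_one (by positivity) hγ2).mul_right _).mul_left _
      · rw [ContinuousLinearMap.norm_smulRight_apply]
        have h1 := hφn n
        rw [hH1, mul_one] at h1
        exact mul_le_mul h1 (htn n) (norm_nonneg _) (by linarith)
    let S : Lp ℝ p (volume : Measure ℝ) →L[ℝ] Lp ℝ p (volume : Measure ℝ) :=
      J.toContinuousLinearMap + ∑' n, T n
    have hSx : ∀ x, S x = J x + ∑' n, φ n x • t n := by
      intro x
      have h1 : HasSum (fun n => T n x) ((∑' n, T n) x) :=
        hTs.hasSum.mapL (ContinuousLinearMap.apply ℝ _ x)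
      have h2 : ∑' n, φ n x • t n = (∑' n, T n) x := h1.tsum_eq
      rw [h2]
      rfl
    have hSH : ∀ n, S (H n) ∈ closedSpan u := by
      intro n
      have h1 : ∑' m, φ m (H n) • t m = t n := by
        rw [tsum_eq_single n fun m hm => by rw [hφ, if_neg hm, zero_smul], hφ, if_pos rfl,
          one_smul]
      rw [hSx, h1, hJt]
      exact Submodule.le_topologicalClosure _ (Submodule.smul_mem _ _ (Submodule.sum_mem _
        fun i _ => Submodule.subset_span ⟨_, rfl⟩))
    have hSmem : ∀ x, S x ∈ closedSpan u := by
      intro x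
      have hx : x ∈ closedSpan H := by rw [hHtop]; trivial
      have h1 : closedSpan H ≤ (closedSpan u).comap S.toLinearMap := by
        refine Submodule.topologicalClosure_minimal _ (Submodule.span_le.2 ?_) ?_
        · rintro _ ⟨n, rfl⟩
          exact hSH n
        · exact (Submodule.isClosed_topologicalClosure _).preimage S.continuous
      exact h1 hx
    refine ⟨S.codRestrict _ hSmem, 1, one_pos, fun x => ?_⟩
    rw [one_mul]
    change ‖x‖ ≤ ‖S x‖
    have h1 : ‖S x‖ ^ p.toReal = ‖x‖ ^ p.toReal + ‖∑' n, φ n x • t n‖ ^ p.toReal := by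
      rw [hSx, norm_add_rpow_of_disjoint hp measurableSet_Ioo hTm hWT
        (LpSupp_mono measurableSet_Ioo measurableSet_Ioo
          (Set.Ioo_subset_Ioo (by norm_num) (by norm_num)) (hJ x))
        (tsum_mem_LpSupp fun n => Submodule.smul_mem _ _ (htT n)), J.norm_map]
    have h2 : 0 ≤ ‖∑' n, φ n x • t n‖ ^ p.toReal := by positivity
    exact (Real.rpow_le_rpow_iff (norm_nonneg _) (norm_nonneg _) hq).1 (by linarith)
  · exact hK'.canBeBlocked hu0 (n := fun j => 2 ^ j - 1) (by simp)
      (strictMono_nat_of_lt_succ fun n => by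
        have := Nat.one_le_two_pow (n := n)
        rw [pow_succ]; omega) hC
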